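/- Let $\mathcal H=\mathcal H_a\otimes\mathcal H_b\otimes\mathcal H_c$ with $\mathcal H_a=\mathbb C^{d_a}$, $\mathcal H_b=\mathbb C^{2}$, $\mathcal H_c=\mathbb C^{d_c}$ and $1\le d_a\le d_c$, and consider the two neighborhoods $ab$ and $bc$. For a unit vector $|\psi\rangle\in\mathcal H$ and a neighborhood $N\in\{ab,bc\}$ with complement $\overline N$, let $\Sigma_N(|\psi\rangle)\subseteq\mathcal H_N$ be the Schmidt span, i.e. the span of the vectors on the $N$ side in the Schmidt decompositions of $|\psi\rangle$ with respect to $\mathcal H_N\otimes\mathcal H_{\overline N}$, and let $\overline\Sigma_N(|\psi\rangle)=\Sigma_N(|\psi\rangle)\otimes\mathcal H_{\overline N}$. Put $$\mathcal H_0(|\psi\rangle)=\overline\Sigma_{ab}(|\psi\rangle)\cap\overline\Sigma_{bc}(|\psi\rangle).$$ The state $|\psi\rangle$ is called DQLS (dissipatively quasi-locally stabilizable) if there are finitely many operators $L_k$ on $\mathcal H$, each of the form $X_{ab}\otimes I_c$ or $I_a\otimes X_{bc}$ and with $L_k|\psi\rangle=0$, such that for $\mathcal L(\rho)=\sum_k\big(L_k\rho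 L_k^\dagger-\tfrac12\{L_k^\dagger L_k,\rho\}\big)$ the state $|\psi\rangle\langle\psi|$ is globally asymptotically stable: $\mathcal L(|\psi\rangle\langle\psi|)=0$ and $\lim_{t\to\infty}e^{t\mathcal L}(\rho_0)=|\psi\rangle\langle\psi|$ for every density operator $\rho_0$ on $\mathcal H$. Then the following holds for a generic state $|\psi\rangle$, that is, for almost every unit vector $|\psi\rangle\in\mathcal H$ with respect to the unitarily invariant (Fubini–Study) probability measure. (i) If $d_c=d_a$, then $\dim\mathcal H_0(|\psi\rangle)=d_a$, and, provided that $d_a\ge2$, $|\psi\rangle$ is not DQLS. (ii) If $d_c>d_a$, then $\dim\mathcal H_0(|\psi\rangle)=\min\{d_a^2,(d_c-d_a)^2\}$. If $d_c=d_a+1$, then $|\psi\rangle$ is DQLS. If $d_c\ne d_a+1$ and $d_a\ge2$, then $|\psi\rangle$ is not DQLS. -/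

import Mathlib

open MeasureTheory Filter Topology Matrix
open scoped Kronecker ComplexOrder

namespace QuasiLocal

noncomputable section

section Bipartite

/-! Bipartite systems. The Hilbert space with orthonormal basis labelled by `ι` is
`EuclideanSpace ℂ ι`, operators on it are matrices indexed by `ι`. A bipartition into a
neighborhood `N` and its complement is an identification `e : ι ≃ α × β` of the basis labels,
with `α` labelling the basis of `H_N` and `β` that of the complement. -/

variable {ι α β : Type*} [Fintype ι] [DecidableEq ι]
  [Fintype α] [DecidableEq α] [Fintype β] [DecidableEq β]

/-- The product vector `a ⊗ b`. -/
def tensorVec (e : ι ≃ α × β) (a : EuclideanSpace ℂ α) (b : EuclideanSpace ℂ β) :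
    EuclideanSpace ℂ ι :=
  WithLp.toLp 2 fun i => a (e i).1 * b (e i).2

/-- `v = ∑ i, μ i • a i ⊗ b i` is a Schmidt decomposition of `v`: the `a i` are orthonormal,
the `b i` are orthonormal and the coefficients are positive. -/
structure IsSchmidtDecomposition (e : ι ≃ α × β) (v : EuclideanSpace ℂ ι) {r : ℕ}
    (μ : Fin r → ℝ) (a : Fin r → EuclideanSpace ℂ α) (b : Fin r → EuclideanSpace ℂ β) :
    Prop where
  pos : ∀ i, 0 < μ i
  left_orthonormal : Orthonormal ℂ a
  right_orthonormal : Orthonormal ℂ b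
  eq_sum : v = ∑ i, (μ i : ℂ) • tensorVec e (a i) (b i)

/-- The Schmidt span of `v` relative to the first factor. -/
def schmidtSpan (e : ι ≃ α × β) (v : EuclideanSpace ℂ ι) :
    Submodule ℂ (EuclideanSpace ℂ α) :=
  Submodule.span ℂ {x | ∃ (r : ℕ) (μ : Fin r → ℝ) (a : Fin r → EuclideanSpace ℂ α)
    (b : Fin r → EuclideanSpace ℂ β), IsSchmidtDecomposition e v μ a b ∧ ∃ i, x = a i}

/-- The extended Schmidt span: (Schmidt span relative to the first factor) ⊗ (second factor). -/
def extendedSchmidtSpan (e : ι ≃ α × β) (v : EuclideanSpace ℂ ι) :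
    Submodule ℂ (EuclideanSpace ℂ ι) :=
  Submodule.span ℂ {w | ∃ a ∈ schmidtSpan e v, ∃ b : EuclideanSpace ℂ β, w = tensorVec e a b}

/-- `L = X ⊗ I` acts non-trivially only on the first factor of the bipartition. -/
def IsNeighborhoodOp (e : ι ≃ α × β) (L : Matrix ι ι ℂ) : Prop :=
  ∃ X : Matrix α α ℂ, L = (X ⊗ₖ (1 : Matrix β β ℂ)).submatrix e e

end Bipartite

section Dynamics

variable {ι κ : Type*} [Fintype ι] [DecidableEq ι] [Fintype κ]

/-- Density operators. -/
def IsDensity (ρ : Matrix ι ι ℂ) : Prop :=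
  ρ.PosSemidef ∧ ρ.trace = 1

/-- The operator `|ψ⟩⟨ψ|`. -/
def pureDensity (ψ : EuclideanSpace ℂ ι) : Matrix ι ι ℂ :=
  vecMulVec ψ.ofLp (star ψ.ofLp)

/-- The Lindblad generator
`ρ ↦ -i [H, ρ] + ∑ k, (L k ρ (L k)† - ½ {(L k)† (L k), ρ})`, as a linear map. -/
def lindbladian (H : Matrix ι ι ℂ) (L : κ → Matrix ι ι ℂ) :
    Matrix ι ι ℂ →ₗ[ℂ] Matrix ι ι ℂ :=
  (-Complex.I) • (LinearMap.mulLeft ℂ H - LinearMap.mulRight ℂ H) +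
    ∑ k, (LinearMap.mulLeft ℂ (L k) ∘ₗ LinearMap.mulRight ℂ (L k)ᴴ -
      (1 / 2 : ℂ) • (LinearMap.mulLeft ℂ ((L k)ᴴ * L k) + LinearMap.mulRight ℂ ((L k)ᴴ * L k)))

/-- The exponential of a linear map on operators, computed through its matrix in the basis of
matrix units. -/
def expMap (G : Matrix ι ι ℂ →ₗ[ℂ] Matrix ι ι ℂ) : Matrix ι ι ℂ →ₗ[ℂ] Matrix ι ι ℂ :=
  Matrix.toLin (Matrix.stdBasis ℂ ι ι) (Matrix.stdBasis ℂ ι ι)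
    (NormedSpace.exp
      (LinearMap.toMatrix (Matrix.stdBasis ℂ ι ι) (Matrix.stdBasis ℂ ι ι) G))

/-- `ρd` is globally asymptotically stable for the semigroup `t ↦ e^{t G}`. -/
def IsGAS (G : Matrix ι ι ℂ →ₗ[ℂ] Matrix ι ι ℂ) (ρd : Matrix ι ι ℂ) : Prop :=
  G ρd = 0 ∧ ∀ ρ₀ : Matrix ι ι ℂ, IsDensity ρ₀ →
    Tendsto (fun t : ℝ => expMap ((t : ℂ) • G) ρ₀) atTop (𝓝 ρd)

end Dynamics

section Generic

variable (ι : Type*) [Fintype ι]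

/-- The Fubini–Study measure, realised on normalized state vectors: the rotation invariant
probability measure on the unit sphere of the Hilbert space. (All properties considered here are
independent of the phase of the state vector.) -/
def fubiniStudy : Measure (Metric.sphere (0 : EuclideanSpace ℂ ι) 1) :=
  ((volume : Measure (EuclideanSpace ℂ ι)).toSphere Set.univ)⁻¹ •
    (volume : Measure (EuclideanSpace ℂ ι)).toSphere

variable {ι}

/-- A property holds for a generic pure state if it holds for Fubini–Study almost every
normalized state vector. -/
def ForGenericState (P : EuclideanSpace ℂ ι → Prop) : Prop :=
  ∀ᵐ ψ : Metric.sphere (0 : EuclideanSpace ℂ ι) 1 ∂(fubiniStudy ι), P ψ.val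

end Generic

section Tripartite

variable {A B C : Type*} [Fintype A] [DecidableEq A] [Fintype B] [DecidableEq B]
  [Fintype C] [DecidableEq C]

/-- The bipartition `ab | c`. -/
def splitAB : A × B × C ≃ (A × B) × C := (Equiv.prodAssoc A B C).symm

/-- The bipartition `bc | a`. -/
def splitBC : A × B × C ≃ (B × C) × A := Equiv.prodComm A (B × C)

/-- The subspace `H₀(ψ)` relative to the neighborhoods `{a, b}` and `{b, c}`. -/
def dqlsSubspace (ψ : EuclideanSpace ℂ (A × B × C)) :
    Submodule ℂ (EuclideanSpace ℂ (A × B × C)) :=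
  extendedSchmidtSpan splitAB ψ ⊓ extendedSchmidtSpan splitBC ψ

/-- `ψ` is dissipatively quasi-locally stabilizable relative to the neighborhoods `{a, b}` and
`{b, c}`: there are finitely many Lindblad operators, each acting on one of the two neighborhoods
and annihilating `ψ`, such that `|ψ⟩⟨ψ|` is globally asymptotically stable for the Lindblad
generator with these operators and zero Hamiltonian. -/
def IsDQLS (ψ : EuclideanSpace ℂ (A × B × C)) : Prop :=
  ∃ (m : ℕ) (L : Fin m → Matrix (A × B × C) (A × B × C) ℂ),
    (∀ k, IsNeighborhoodOp splitAB (L k) ∨ IsNeighborhoodOp splitBC (L k)) ∧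
    (∀ k, L k *ᵥ ψ.ofLp = 0) ∧
    IsGAS (lindbladian 0 L) (pureDensity ψ)

end Tripartite

end

end QuasiLocal

/-!
# Generic dissipative quasi-local stabilizability of `a - b - c` states with a qubit `b`

A vector `ψ` of `ℂ^m ⊗ ℂ² ⊗ ℂ^n` is a pair of `m × n` matrices `M₀`, `M₁` (`slice`), that is, a
representation of the Kronecker quiver. The Schmidt span of `ψ` is the column space of its
coefficient matrix (`mem_schmidtSpan`), so `H₀(ψ)` consists of the vectors with slices
`X M_b = M_b Y` (`mem_dqlsSubspace`). It is essentially the endomorphism algebra of the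
representation, the kernel of the Sylvester map `(X, Y) ↦ (X M_b - M_b Y)_b`.

*Dimension.* A linear family of linear maps that is injective (surjective) at one point is so at
almost every point, because a determinant has finitely many zeros on each line in the direction of
that point (`forGenericState_injective`, `forGenericState_surjective`). For `m < n` the witness is
the band pencil `M₀ = [I 0]`, `M₁ = [0 I]`, whose Sylvester map is surjective
(`sylvester_bandVec_surjective`); hence generically its kernel has dimension
`m² + n² - 2mn = (n - m)²`. This is `dim H₀` when the reduced state on `c` has full rank, which is
generic for `n ≤ 2m`. For `n ≥ 2m` the Schmidt span on `ab` is generically everything, `Y` is no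
constraint, and the dimension is `m²`. For `m = n`, `H₀` is the commutant of `M₁ M₀⁻¹`. Generically
a matrix in the commutant is determined by its value on one suitable vector, and then all values
occur (`exists_commute_mulVec_eq`), so the dimension is `m`.

*Stabilizability.* Admissible Lindblad operators annihilate all of `H₀(ψ)`, hence if its dimension
is at least two there are other stationary pure states (`not_isDQLS_of_two_le_finrank`).
Conversely, suppose `H₀(ψ)` is the line through `ψ` and the reduced states on `a` and `c` have
full rank. Let the Lindblad operators move the complement of each Schmidt span onto arbitrary
vectors (`pumpOp`). No vector independent of `ψ` is orthogonal to all `(L k)ᴴ ψ`, so the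
population `⟨ψ|ρ|ψ⟩` grows at a rate at least `ε (1 - ⟨ψ|ρ|ψ⟩)` (`isGAS_lindbladian`). This gives
convergence once the semigroup is known to preserve positivity; with the complementary projections
among the Lindblad operators, the generator is a completely positive map minus a multiple of the
identity (`posSemidef_lindbladian_pumpOp_add`), and positivity is visible from the exponential
series.
-/

namespace QuasiLocal

noncomputable section

/-! ### Generic states -/

/-- A property that holds almost everywhere in the Hilbert space and is invariant under positive
rescaling holds for a generic state. -/
theorem forGenericState_of_ae {ι : Type*} [Fintype ι] {s : Set (EuclideanSpace ℂ ι)}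
    (hs : MeasurableSet s) (hsmul : ∀ x, ∀ r : ℝ, 0 < r → r • x ∈ s → x ∈ s)
    (hae : ∀ᵐ x : EuclideanSpace ℂ ι, x ∈ s) : ForGenericState fun ψ => ψ ∈ s := by
  unfold ForGenericState fubiniStudy
  refine Measure.ae_smul_measure ?_ _
  rw [ae_iff]
  change volume.toSphere (Subtype.val ⁻¹' s)ᶜ = 0
  rw [Measure.toSphere_apply' _ (measurable_subtype_coe hs).compl]
  refine mul_eq_zero_of_right _ (measure_mono_null ?_ (ae_iff.1 hae))
  rintro _ ⟨r, hr, _, ⟨x, hx, rfl⟩, rfl⟩ h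
  exact hx (hsmul _ r hr.1 h)

/-- Along each line in the direction `v`, the determinant vanishes at most at the finitely many
negatives of eigenvalues of `S x`. -/
theorem forGenericState_det_ne_zero {ι Y : Type*} [Fintype ι] [AddCommGroup Y] [Module ℂ Y]
    [FiniteDimensional ℂ Y] (S : EuclideanSpace ℂ ι →ₗ[ℂ] (Y →ₗ[ℂ] Y)) (v : EuclideanSpace ℂ ι)
    (hv : S v = LinearMap.id) :
    ForGenericState fun ψ : EuclideanSpace ℂ ι => LinearMap.det (S ψ) ≠ 0 := by
  have hcont : Continuous fun ψ : EuclideanSpace ℂ ι => LinearMap.det (S ψ) := by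
    let b := Module.finBasis ℂ Y
    have h1 : Continuous ((LinearMap.toMatrix b b).toLinearMap ∘ₗ S) :=
      LinearMap.continuous_of_finiteDimensional _
    have h2 : (fun ψ : EuclideanSpace ℂ ι => LinearMap.det (S ψ)) =
        fun ψ => (((LinearMap.toMatrix b b).toLinearMap ∘ₗ S) ψ).det := by
      funext ψ
      simp [LinearMap.det_toMatrix]
    rw [h2]
    exact h1.matrix_det
  have hmeas : MeasurableSet {ψ : EuclideanSpace ℂ ι | LinearMap.det (S ψ) ≠ 0} :=
    (isOpen_ne_fun hcont continuous_const).measurableSet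
  refine forGenericState_of_ae hmeas ?_ ?_
  · intro x r _ h h0
    apply h
    have : r • x = (r : ℂ) • x := by ext i; simp
    rw [this, map_smul, LinearMap.det_smul, h0, mul_zero]
  · refine ae_mem_of_ae_add_linearMap_mem (LinearMap.toSpanSingleton ℝ _ v)
      (volume : Measure ℝ) volume hmeas fun x => ?_
    have hfin : {t : ℝ | (-(t : ℂ)) ∈ {μ | Module.End.HasEigenvalue (S x) μ}}.Finite := by
      refine Set.Finite.preimage ?_ (Module.End.finite_hasEigenvalue (S x))
      intro a _ b _ hab
      simpa using hab
    filter_upwards [hfin.countable.ae_notMem (volume : Measure ℝ)] with t ht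
    intro h0
    apply ht
    have hS : S (x + (LinearMap.toSpanSingleton ℝ _ v) t) = S x - (-(t : ℂ)) • LinearMap.id := by
      have : (LinearMap.toSpanSingleton ℝ _ v) t = (t : ℂ) • v := by ext i; simp
      rw [this, map_add, map_smul, hv, neg_smul, sub_neg_eq_add]
    rw [hS] at h0
    have hk := LinearMap.bot_lt_ker_of_det_eq_zero h0
    show Module.End.HasEigenvalue _ _
    rw [Module.End.hasEigenvalue_iff, Module.End.eigenspace_def]
    exact hk.ne'

/-- A linear family of linear maps that is surjective at one point is generically surjective. -/
theorem forGenericState_surjective {ι X Y : Type*} [Fintype ι] [AddCommGroup X] [Module ℂ X]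
    [AddCommGroup Y] [Module ℂ Y] [FiniteDimensional ℂ Y]
    (T : EuclideanSpace ℂ ι →ₗ[ℂ] (X →ₗ[ℂ] Y)) (v : EuclideanSpace ℂ ι)
    (hv : Function.Surjective (T v)) :
    ForGenericState fun ψ : EuclideanSpace ℂ ι => Function.Surjective (T ψ) := by
  obtain ⟨R, hR⟩ := (T v).exists_rightInverse_of_surjective (LinearMap.range_eq_top.2 hv)
  filter_upwards [forGenericState_det_ne_zero ((LinearMap.lcomp ℂ Y R) ∘ₗ T) v hR] with ψ hψ
  have h : Function.Surjective (T ψ ∘ₗ R) :=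
    ((LinearMap.equivOfDetNeZero _ hψ).surjective)
  exact Function.Surjective.of_comp h

/-- A linear family of linear maps that is injective at one point is generically injective. -/
theorem forGenericState_injective {ι X Y : Type*} [Fintype ι] [AddCommGroup X] [Module ℂ X]
    [AddCommGroup Y] [Module ℂ Y] [FiniteDimensional ℂ X]
    (T : EuclideanSpace ℂ ι →ₗ[ℂ] (X →ₗ[ℂ] Y)) (v : EuclideanSpace ℂ ι)
    (hv : Function.Injective (T v)) :
    ForGenericState fun ψ : EuclideanSpace ℂ ι => Function.Injective (T ψ) := by
  obtain ⟨R, hR⟩ := (T v).exists_leftInverse_of_injective (LinearMap.ker_eq_bot.2 hv)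
  filter_upwards [forGenericState_det_ne_zero ((LinearMap.llcomp ℂ X Y X R) ∘ₗ T) v hR] with ψ hψ
  have h : Function.Injective (R ∘ₗ T ψ) :=
    ((LinearMap.equivOfDetNeZero _ hψ).injective)
  exact Function.Injective.of_comp h

/-! ### Schmidt spans -/

section Schmidt

variable {ι α β : Type*}

/-- The coefficients of `v` as a matrix, the rows labelled by the first factor. -/
def coeffMatrix (e : ι ≃ α × β) : EuclideanSpace ℂ ι →ₗ[ℂ] Matrix α β ℂ where
  toFun v := Matrix.of fun i j => v (e.symm (i, j))
  map_add' _ _ := rfl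
  map_smul' _ _ := rfl

theorem coeffMatrix_apply (e : ι ≃ α × β) (v : EuclideanSpace ℂ ι) (i : α) (j : β) :
    coeffMatrix e v i j = v (e.symm (i, j)) := rfl

theorem coeffMatrix_tensorVec (e : ι ≃ α × β) (a : EuclideanSpace ℂ α) (b : EuclideanSpace ℂ β) :
    coeffMatrix e (tensorVec e a b) = vecMulVec a.ofLp b.ofLp := by
  ext i j
  simp [coeffMatrix_apply, tensorVec, vecMulVec_apply]

theorem coeffMatrix_injective (e : ι ≃ α × β) : Function.Injective (coeffMatrix e) := by
  intro v w h
  ext i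
  have := congrFun (congrFun h (e i).1) (e i).2
  simpa [coeffMatrix_apply] using this

/-- Let `V` be the coefficient matrix. The eigenvectors `a` of `V Vᴴ` with positive eigenvalue,
together with the normalized row vectors `aᴴ V`, form a Schmidt decomposition. -/
theorem exists_isSchmidtDecomposition [Fintype α] [Fintype β] (e : ι ≃ α × β)
    (v : EuclideanSpace ℂ ι) :
    ∃ (r : ℕ) (μ : Fin r → ℝ) (a : Fin r → EuclideanSpace ℂ α) (b : Fin r → EuclideanSpace ℂ β),
      IsSchmidtDecomposition e v μ a b := by
  classical
  set V := coeffMatrix e v with hV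
  have hA : (V * Vᴴ).IsHermitian := isHermitian_mul_conjTranspose_self V
  have hpsd : (V * Vᴴ).PosSemidef := posSemidef_self_mul_conjTranspose V
  set a := hA.eigenvectorBasis
  set lam := hA.eigenvalues with hlam
  have hlam0 : ∀ i, 0 ≤ lam i := hpsd.eigenvalues_nonneg
  let c : α → β → ℂ := fun i => star (a i).ofLp ᵥ* V
  have hexp : ∀ k j, V k j = ∑ i, c i j * a i k := by
    intro k j
    have h := a.sum_repr' (WithLp.toLp 2 (V.col j))
    have h2 := congrArg (fun x : EuclideanSpace ℂ α => x k) h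
    simp only [WithLp.ofLp_sum, Finset.sum_apply, WithLp.ofLp_smul, Pi.smul_apply,
      smul_eq_mul] at h2
    rw [show V k j = V.col j k from rfl, ← h2]
    refine Finset.sum_congr rfl fun i _ => ?_
    congr 1
    simp only [EuclideanSpace.inner_eq_star_dotProduct, c, vecMul, dotProduct_comm]
    rfl
  have hcc : ∀ i i', star (c i) ⬝ᵥ c i' = if i = i' then (lam i : ℂ) else 0 := by
    intro i i'
    have h1 : star (c i) = Vᴴ *ᵥ (a i).ofLp := by
      simp only [c, star_vecMul, star_star]
    have h2 : star (c i) ⬝ᵥ c i' = star (a i').ofLp ⬝ᵥ ((V * Vᴴ) *ᵥ (a i).ofLp) := by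
      rw [h1, dotProduct_comm, ← dotProduct_mulVec, mulVec_mulVec]
    rw [h2, hA.mulVec_eigenvectorBasis]
    have h3 := orthonormal_iff_ite.1 a.orthonormal i' i
    rw [EuclideanSpace.inner_eq_star_dotProduct, dotProduct_comm] at h3
    rw [dotProduct_smul, h3]
    by_cases h : i = i'
    · subst h; simp [hlam]
    · simp [h, Ne.symm h]
  have hc0 : ∀ i, lam i = 0 → c i = 0 := by
    intro i hi
    have := hcc i i
    rw [if_pos rfl, hi, Complex.ofReal_zero] at this
    exact dotProduct_star_self_eq_zero.1 this
  let p := {i // 0 < lam i}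
  let f : Fin (Fintype.card p) ≃ p := (Fintype.equivFin p).symm
  refine ⟨Fintype.card p, fun i => √(lam (f i)), fun i => a (f i),
    fun i => WithLp.toLp 2 (((√(lam (f i)) : ℝ) : ℂ)⁻¹ • c (f i)), ?_, ?_, ?_, ?_⟩
  · exact fun i => Real.sqrt_pos.2 (f i).2
  · exact a.orthonormal.comp _ (Subtype.val_injective.comp f.injective)
  · rw [orthonormal_iff_ite]
    intro i j
    rw [EuclideanSpace.inner_eq_star_dotProduct, dotProduct_comm]
    simp only [star_smul, smul_dotProduct, dotProduct_smul, hcc]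
    by_cases h : i = j
    · subst h
      have h0 : ((√(lam (f i)) : ℝ) : ℂ) ≠ 0 := by
        exact_mod_cast (Real.sqrt_pos.2 (f i).2).ne'
      have h1 : ((lam (f i) : ℝ) : ℂ) = ((√(lam (f i)) : ℝ) : ℂ) * ((√(lam (f i)) : ℝ) : ℂ) := by
        rw [← Complex.ofReal_mul, Real.mul_self_sqrt (hlam0 _)]
      simp only [if_true, smul_eq_mul]
      rw [h1]
      simp only [star_inv₀, Complex.star_def, Complex.conj_ofReal]
      field_simp
    · have : ((f i : p) : α) ≠ (f j : p) := fun h' => h (f.injective (Subtype.ext h'))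
      simp [this, h]
  · apply coeffMatrix_injective e
    rw [map_sum]
    ext k j
    rw [← hV, hexp, Matrix.sum_apply]
    simp only [map_smul, coeffMatrix_tensorVec, Matrix.smul_apply, vecMulVec_apply]
    rw [Equiv.sum_comp f (fun x : p => ((√(lam x) : ℝ) : ℂ) • (a x k *
      ((((√(lam x) : ℝ) : ℂ)⁻¹ • c x) j)))]
    rw [← Finset.sum_subtype (Finset.univ.filter fun i => 0 < lam i) (by simp)
      (fun x => ((√(lam x) : ℝ) : ℂ) • (a x k * ((((√(lam x) : ℝ) : ℂ)⁻¹ • c x) j)))]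
    rw [Finset.sum_filter]
    refine Finset.sum_congr rfl fun i _ => ?_
    split_ifs with h
    · have h0 : ((√(lam i) : ℝ) : ℂ) ≠ 0 := by
        exact_mod_cast (Real.sqrt_pos.2 h).ne'
      simp only [Pi.smul_apply, smul_eq_mul]
      field_simp
    · rw [hc0 i (le_antisymm (not_lt.1 h) (hlam0 i)), Pi.zero_apply, zero_mul]

/-- The Schmidt span is the column space of the coefficient matrix. -/
theorem mem_schmidtSpan [Fintype α] [Fintype β] {e : ι ≃ α × β} {v : EuclideanSpace ℂ ι}
    {x : EuclideanSpace ℂ α} :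
    x ∈ schmidtSpan e v ↔ ∃ y : β → ℂ, x.ofLp = coeffMatrix e v *ᵥ y := by
  constructor
  · intro hx
    suffices h : schmidtSpan e v ≤ (LinearMap.range (coeffMatrix e v).mulVecLin).comap
        (WithLp.linearEquiv 2 ℂ (α → ℂ)).toLinearMap by
      obtain ⟨y, hy⟩ := h hx
      exact ⟨y, hy.symm⟩
    refine Submodule.span_le.2 ?_
    rintro _ ⟨r, μ, a, b, hs, i, rfl⟩
    refine ⟨(μ i : ℂ)⁻¹ • star (b i).ofLp, ?_⟩
    have h0 : (μ i : ℂ) ≠ 0 := by exact_mod_cast (hs.pos i).ne'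
    have hb := orthonormal_iff_ite.1 hs.right_orthonormal
    simp only [EuclideanSpace.inner_eq_star_dotProduct] at hb
    rw [hs.eq_sum, map_sum, mulVecLin_apply, sum_mulVec, Finset.sum_eq_single i]
    · simp only [map_smul, coeffMatrix_tensorVec, mulVec_smul, smul_mulVec, vecMulVec_mulVec, hb]
      ext k
      simp only [if_true, MulOpposite.op_one, one_smul, Pi.smul_apply, smul_eq_mul]
      field_simp
      rfl
    · intro j _ hj
      simp only [map_smul, coeffMatrix_tensorVec, mulVec_smul, smul_mulVec, vecMulVec_mulVec, hb]
      simp [Ne.symm hj]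
    · simp
  · rintro ⟨y, hy⟩
    obtain ⟨r, μ, a, b, hs⟩ := exists_isSchmidtDecomposition e v
    have hx : x = ∑ i, ((μ i : ℂ) * ((b i).ofLp ⬝ᵥ y)) • a i := by
      ext k
      rw [hy, hs.eq_sum, map_sum, sum_mulVec]
      simp only [map_smul, coeffMatrix_tensorVec, smul_mulVec, vecMulVec_mulVec,
        WithLp.ofLp_sum, Finset.sum_apply, WithLp.ofLp_smul, Pi.smul_apply]
      refine Finset.sum_congr rfl fun i _ => ?_
      simp
      ring
    rw [hx]
    exact Submodule.sum_mem _ fun i _ => Submodule.smul_mem _ _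
      (Submodule.subset_span ⟨r, μ, a, b, hs, i, rfl⟩)

/-- The extended Schmidt span consists of the vectors obtained from `v` by an arbitrary operation
on the second factor. -/
theorem mem_extendedSchmidtSpan [Fintype α] [Fintype β] {e : ι ≃ α × β} {v w : EuclideanSpace ℂ ι} :
    w ∈ extendedSchmidtSpan e v ↔ ∃ Y : Matrix β β ℂ, coeffMatrix e w = coeffMatrix e v * Y := by
  classical
  constructor
  · intro hw
    suffices h : extendedSchmidtSpan e v ≤
        (LinearMap.range (mulLeftLinearMap β ℂ (coeffMatrix e v))).comap (coeffMatrix e) by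
      obtain ⟨Y, hY⟩ := h hw
      exact ⟨Y, hY.symm⟩
    refine Submodule.span_le.2 ?_
    rintro _ ⟨a, ha, b, rfl⟩
    obtain ⟨y, hy⟩ := mem_schmidtSpan.1 ha
    refine ⟨vecMulVec y b.ofLp, ?_⟩
    rw [coeffMatrix_tensorVec, hy]
    exact mul_vecMulVec _ _ _
  · rintro ⟨Y, hY⟩
    have hw' : w = ∑ j, tensorVec e (WithLp.toLp 2 (coeffMatrix e v *ᵥ Y.col j))
        (EuclideanSpace.single j 1) := by
      apply coeffMatrix_injective e
      ext k l
      rw [map_sum, hY, Matrix.sum_apply, Finset.sum_eq_single l]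
      · simp [coeffMatrix_tensorVec, vecMulVec_apply, mulVec, mul_apply, dotProduct]
      · intro j _ hj
        simp [coeffMatrix_tensorVec, vecMulVec_apply, Ne.symm hj]
      · simp
    rw [hw']
    exact Submodule.sum_mem _ fun j _ => Submodule.subset_span
      ⟨_, mem_schmidtSpan.2 ⟨_, rfl⟩, _, rfl⟩

theorem coeffMatrix_mulVec [Fintype ι] [Fintype α] [DecidableEq α] [Fintype β] [DecidableEq β]
    (e : ι ≃ α × β) (X : Matrix α α ℂ) (v : EuclideanSpace ℂ ι) :
    coeffMatrix e (WithLp.toLp 2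
      ((X ⊗ₖ (1 : Matrix β β ℂ)).submatrix e e *ᵥ v.ofLp)) = X * coeffMatrix e v := by
  ext i j
  simp only [coeffMatrix_apply, mulVec, dotProduct, submatrix_apply, kroneckerMap_apply,
    Equiv.apply_symm_apply, mul_apply]
  rw [← Equiv.sum_comp e.symm, Fintype.sum_prod_type]
  refine Finset.sum_congr rfl fun k _ => ?_
  rw [Finset.sum_eq_single j]
  · rw [Equiv.apply_symm_apply]
    simp
  · intro l _ hl
    rw [Equiv.apply_symm_apply]
    simp [one_apply, Ne.symm hl]
  · simp

end Schmidt

/-! ### The exponential of a generator -/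

section Exponential

variable {ι : Type*} [Fintype ι] [DecidableEq ι]

/-- The exponential of a linear map on operators, expressed through algebra equivalences. -/
theorem expMap_eq (G : Module.End ℂ (Matrix ι ι ℂ)) :
    expMap G = Matrix.toLinAlgEquiv (Matrix.stdBasis ℂ ι ι)
      (NormedSpace.exp (LinearMap.toMatrixAlgEquiv (Matrix.stdBasis ℂ ι ι) G)) := rfl

attribute [local instance] Matrix.linftyOpNormedRing Matrix.linftyOpNormedAlgebra in
/-- The exponential series, evaluated at an operator. -/
theorem hasSum_expMap (G : Module.End ℂ (Matrix ι ι ℂ)) (ρ : Matrix ι ι ℂ) :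
    HasSum (fun n : ℕ => ((n.factorial : ℂ)⁻¹) • (G ^ n) ρ) (expMap G ρ) := by
  set B := Matrix.stdBasis ℂ ι ι
  have h := NormedSpace.exp_series_hasSum_exp' (𝕂 := ℂ) (LinearMap.toMatrixAlgEquiv B G)
  let ev : Matrix (ι × ι) (ι × ι) ℂ →ₗ[ℂ] Matrix ι ι ℂ :=
    LinearMap.applyₗ ρ ∘ₗ (Matrix.toLinAlgEquiv B).toLinearMap
  have h2 := h.map ev (LinearMap.continuous_of_finiteDimensional ev)
  have h3 : (⇑ev ∘ fun n : ℕ => ((n.factorial : ℂ)⁻¹) • LinearMap.toMatrixAlgEquiv B G ^ n)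
      = fun n : ℕ => ((n.factorial : ℂ)⁻¹) • (G ^ n) ρ := by
    funext n
    simp only [Function.comp, map_smul]
    congr 1
    simp only [ev, LinearMap.comp_apply, LinearMap.applyₗ_apply_apply, AlgEquiv.toLinearMap_apply]
    rw [map_pow, Matrix.toLinAlgEquiv_toMatrixAlgEquiv]
  rw [h3] at h2
  exact h2

/-- A stationary operator does not move. -/
theorem expMap_apply_of_apply_eq_zero {G : Module.End ℂ (Matrix ι ι ℂ)} {ρ : Matrix ι ι ℂ}
    (h : G ρ = 0) : expMap G ρ = ρ := by
  refine (hasSum_expMap G ρ).unique ?_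
  convert hasSum_single 0 ?_ using 1
  · simp
  · intro n hn
    obtain ⟨k, rfl⟩ := Nat.exists_eq_succ_of_ne_zero hn
    simp [pow_succ, h]

theorem expMap_sub_smul_one (G : Module.End ℂ (Matrix ι ι ℂ)) (c : ℂ) :
    expMap (G - c • (1 : Module.End ℂ (Matrix ι ι ℂ))) = Complex.exp (-c) • expMap G := by
  have h : G - c • (1 : Module.End ℂ (Matrix ι ι ℂ)) = G + (-c) • 1 := by
    ext ρ : 1
    simp [sub_eq_add_neg]
  rw [h, expMap_eq, expMap_eq, map_add, map_smul, map_one,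
    Matrix.exp_add_of_commute _ _ ((Commute.one_right _).smul_right _), ← map_smul]
  congr 1
  have : (-c) • (1 : Matrix (ι × ι) (ι × ι) ℂ) = diagonal fun _ => -c := by
    rw [smul_one_eq_diagonal]
  rw [this, Matrix.exp_diagonal, Pi.exp_def]
  ext i j
  simp [Complex.exp_eq_exp_ℂ, mul_comm]

end Exponential

/-! ### Convergence to a pure state -/

section Convergence

variable {ι : Type*} [Fintype ι]

theorem isClosed_posSemidef : IsClosed {A : Matrix ι ι ℂ | A.PosSemidef} := by
  have h : {A : Matrix ι ι ℂ | A.PosSemidef} =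
      {A | Aᴴ = A} ∩ ⋂ x : ι → ℂ, {A | 0 ≤ star x ⬝ᵥ (A *ᵥ x)} := by
    ext A
    simp [posSemidef_iff_dotProduct_mulVec, IsHermitian]
  rw [h]
  refine (isClosed_eq (by fun_prop) continuous_id).inter (isClosed_iInter fun x => ?_)
  exact isClosed_le continuous_const (by fun_prop)

/-- The exponential of a positive map is positive, as the terms of its series are. -/
theorem posSemidef_expMap [DecidableEq ι] {E : Module.End ℂ (Matrix ι ι ℂ)}
    (hE : ∀ ρ : Matrix ι ι ℂ, ρ.PosSemidef → (E ρ).PosSemidef) {t : ℝ} (ht : 0 ≤ t)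
    {ρ : Matrix ι ι ℂ} (hρ : ρ.PosSemidef) : (expMap ((t : ℂ) • E) ρ).PosSemidef := by
  have hpow : ∀ n : ℕ, ((E ^ n) ρ).PosSemidef := by
    intro n
    induction n with
    | zero => simpa using hρ
    | succ n ih => rw [pow_succ', Module.End.mul_apply]; exact hE _ ih
  refine isClosed_posSemidef.mem_of_tendsto (hasSum_expMap ((t : ℂ) • E) ρ).tendsto_sum_nat
    (Eventually.of_forall fun N => ?_)
  refine posSemidef_sum _ fun n _ => ?_
  rw [smul_pow, LinearMap.smul_apply]
  have h1 : (0 : ℂ) ≤ (n.factorial : ℂ)⁻¹ := by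
    rw [inv_nonneg]; exact_mod_cast Nat.zero_le _
  have h2 : (0 : ℂ) ≤ (t : ℂ) ^ n := pow_nonneg (by exact_mod_cast ht) n
  exact ((hpow n).smul h2).smul h1

theorem star_dotProduct_self (ψ : EuclideanSpace ℂ ι) (hψ : ‖ψ‖ = 1) :
    star ψ.ofLp ⬝ᵥ ψ.ofLp = 1 := by
  rw [dotProduct_comm, ← EuclideanSpace.inner_eq_star_dotProduct,
    inner_self_eq_norm_sq_to_K, hψ]
  simp

theorem pureDensity_posSemidef (ψ : EuclideanSpace ℂ ι) : (pureDensity ψ).PosSemidef :=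
  posSemidef_vecMulVec_self_star _

theorem trace_pureDensity (ψ : EuclideanSpace ℂ ι) (hψ : ‖ψ‖ = 1) : (pureDensity ψ).trace = 1 := by
  rw [pureDensity, trace_vecMulVec, dotProduct_comm, star_dotProduct_self ψ hψ]

theorem pureDensity_mul_self (ψ : EuclideanSpace ℂ ι) (hψ : ‖ψ‖ = 1) :
    pureDensity ψ * pureDensity ψ = pureDensity ψ := by
  rw [pureDensity, vecMulVec_mul_vecMulVec, star_dotProduct_self ψ hψ, one_smul]

theorem trace_mul_nonneg [DecidableEq ι] {A B : Matrix ι ι ℂ} (hA : A.PosSemidef)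
    (hB : B.PosSemidef) : 0 ≤ (A * B).trace := by
  open scoped MatrixOrder in
  obtain ⟨C, rfl⟩ := CStarAlgebra.nonneg_iff_eq_star_mul_self.mp hB.nonneg
  rw [← mul_assoc, trace_mul_comm, ← mul_assoc]
  exact (hA.mul_mul_conjTranspose_same C).trace_nonneg

/-- The purity of a density operator is at most one, because the principal minors of order two are
nonnegative. -/
theorem re_trace_mul_self_le [DecidableEq ι] {ρ : Matrix ι ι ℂ} (hρ : IsDensity ρ) :
    (ρ * ρ).trace.re ≤ 1 := by
  have hm : ∀ i j, (ρ i j * ρ j i).re ≤ (ρ i i * ρ j j).re := by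
    intro i j
    have h := (hρ.1.submatrix ![i, j]).det_nonneg
    rw [det_fin_two] at h
    simp only [submatrix_apply, Matrix.cons_val_zero, Matrix.cons_val_one] at h
    have := (Complex.le_def.1 h).1
    simp only [Complex.zero_re, Complex.sub_re] at this
    linarith
  have h1 : (ρ * ρ).trace = ∑ i, ∑ j, ρ i j * ρ j i := by
    simp [trace, mul_apply]
  have h2 : (∑ i, ∑ j, ρ i i * ρ j j) = 1 := by
    have := hρ.2
    rw [← Finset.sum_mul_sum]
    simp only [trace, diag_apply] at this
    rw [this, one_mul]
  rw [h1, ← Complex.one_re, ← h2, Complex.re_sum, Complex.re_sum]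
  refine Finset.sum_le_sum fun i _ => ?_
  rw [Complex.re_sum, Complex.re_sum]
  exact Finset.sum_le_sum fun j _ => hm i j

/-- A density operator is close to `|ψ⟩⟨ψ|` as soon as its infidelity with `ψ` is small. -/
theorem norm_sub_pureDensity_sq_le [DecidableEq ι] {ψ : EuclideanSpace ℂ ι} (hψ : ‖ψ‖ = 1)
    {ρ : Matrix ι ι ℂ} (hρ : IsDensity ρ) (i j : ι) :
    ‖(ρ - pureDensity ψ) i j‖ ^ 2 ≤ 2 * ((1 - pureDensity ψ) * ρ).trace.re := by
  set P := pureDensity ψ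
  have hP : Pᴴ = P := (pureDensity_posSemidef ψ).isHermitian
  have hD : (ρ - P)ᴴ = ρ - P := by rw [conjTranspose_sub, hρ.1.isHermitian, hP]
  have h1 : ((ρ - P)ᴴ * (ρ - P)).trace.re = ∑ j, ∑ i, ‖(ρ - P) i j‖ ^ 2 := by
    simp only [trace, diag_apply, mul_apply, conjTranspose_apply, Complex.re_sum]
    refine Finset.sum_congr rfl fun j _ => Finset.sum_congr rfl fun i _ => ?_
    rw [Complex.star_def, Complex.conj_mul', ← Complex.ofReal_pow, Complex.ofReal_re]
  have h2 : ((ρ - P)ᴴ * (ρ - P)).trace = (ρ * ρ).trace - 2 * (P * ρ).trace + 1 := by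
    rw [hD, sub_mul, mul_sub, mul_sub, trace_sub, trace_sub, trace_sub, trace_mul_comm ρ P,
      pureDensity_mul_self ψ hψ, trace_pureDensity ψ hψ]
    ring
  have h3 : ((1 - P) * ρ).trace = 1 - (P * ρ).trace := by
    rw [sub_mul, one_mul, trace_sub, hρ.2]
  have h4 := re_trace_mul_self_le hρ
  have h5 : ‖(ρ - P) i j‖ ^ 2 ≤ ∑ j, ∑ i, ‖(ρ - P) i j‖ ^ 2 := by
    refine le_trans ?_ (Finset.single_le_sum (f := fun j => ∑ i, ‖(ρ - P) i j‖ ^ 2)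
      (fun j _ => Finset.sum_nonneg fun i _ => by positivity) (Finset.mem_univ j))
    exact Finset.single_le_sum (f := fun i => ‖(ρ - P) i j‖ ^ 2)
      (fun i _ => by positivity) (Finset.mem_univ i)
  rw [← h1, h2] at h5
  rw [h3]
  simp only [Complex.add_re, Complex.sub_re, Complex.mul_re, Complex.one_re, Complex.re_ofNat,
    Complex.im_ofNat, zero_mul, sub_zero] at h5 ⊢
  linarith

/-- A trace preserving generator which becomes a positive map after adding `c` and under which the
infidelity with `ψ` decays at least at rate `ε` makes `|ψ⟩⟨ψ|` globally asymptotically stable. -/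
theorem isGAS_of_infidelity_decay [DecidableEq ι] {ψ : EuclideanSpace ℂ ι} (hψ : ‖ψ‖ = 1)
    (G : Module.End ℂ (Matrix ι ι ℂ)) {c ε : ℝ} (hε : 0 < ε) (hc : ε ≤ c)
    (hpos : ∀ ρ : Matrix ι ι ℂ, ρ.PosSemidef → (G ρ + (c : ℂ) • ρ).PosSemidef)
    (htr : ∀ ρ, (G ρ).trace = 0) (h0 : G (pureDensity ψ) = 0)
    (hdec : ∀ ρ : Matrix ι ι ℂ, ρ.PosSemidef → ((1 - pureDensity ψ) * G ρ).trace.re ≤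
      -ε * ((1 - pureDensity ψ) * ρ).trace.re) :
    IsGAS G (pureDensity ψ) := by
  refine ⟨h0, fun ρ hρ => ?_⟩
  set P := pureDensity ψ with hPdef
  set E : Module.End ℂ (Matrix ι ι ℂ) := G + (c : ℂ) • 1 with hEdef
  have hE : ∀ ρ : Matrix ι ι ℂ, E ρ = G ρ + (c : ℂ) • ρ := fun ρ => by simp [hEdef]
  have hEpos : ∀ ρ : Matrix ι ι ℂ, ρ.PosSemidef → (E ρ).PosSemidef := fun ρ h => by
    rw [hE]; exact hpos ρ h
  have hexp : ∀ t : ℝ, expMap ((t : ℂ) • G) ρ =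
      (Real.exp (-(t * c)) : ℂ) • expMap ((t : ℂ) • E) ρ := by
    intro t
    have : (t : ℂ) • G = (t : ℂ) • E - ((t * c : ℝ) : ℂ) • (1 : Module.End ℂ (Matrix ι ι ℂ)) := by
      ext σ : 1
      rw [LinearMap.sub_apply, LinearMap.smul_apply, LinearMap.smul_apply, LinearMap.smul_apply, hE,
        Module.End.one_apply, smul_add, smul_smul, Complex.ofReal_mul, add_sub_cancel_right]
    rw [this, expMap_sub_smul_one, LinearMap.smul_apply, Complex.ofReal_exp, Complex.ofReal_neg]
  let q : Matrix ι ι ℂ →ₗ[ℂ] ℂ := traceLinearMap ι ℂ ℂ ∘ₗ LinearMap.mulLeft ℂ (1 - P)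
  -- `c - ε` is nonnegative, so the bound on the infidelity can be iterated
  have hpow : ∀ n : ℕ, ((E ^ n) ρ).PosSemidef ∧ (q ((E ^ n) ρ)).re ≤ (c - ε) ^ n * (q ρ).re := by
    intro n
    induction n with
    | zero => simpa using hρ.1
    | succ n ih =>
      rw [pow_succ', Module.End.mul_apply]
      refine ⟨hEpos _ ih.1, ?_⟩
      have h1 : (q (G ((E ^ n) ρ))).re ≤ -ε * (q ((E ^ n) ρ)).re := hdec _ ih.1
      have h2 : (q (E ((E ^ n) ρ))).re =
          (q (G ((E ^ n) ρ))).re + c * (q ((E ^ n) ρ)).re := by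
        rw [hE, map_add, map_smul, Complex.add_re, smul_eq_mul, Complex.re_ofReal_mul]
      rw [h2]
      calc _ ≤ -ε * (q ((E ^ n) ρ)).re + c * (q ((E ^ n) ρ)).re := by linarith
        _ = (c - ε) * (q ((E ^ n) ρ)).re := by ring
        _ ≤ (c - ε) * ((c - ε) ^ n * (q ρ).re) :=
            mul_le_mul_of_nonneg_left ih.2 (sub_nonneg.2 hc)
        _ = _ := by ring
  have hsum : ∀ t : ℝ, 0 ≤ t → (q (expMap ((t : ℂ) • G) ρ)).re ≤
      Real.exp (-(t * ε)) * (q ρ).re := by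
    intro t ht
    have hs := (hasSum_expMap ((t : ℂ) • E) ρ).map q
      (LinearMap.continuous_of_finiteDimensional q)
    have hs' := hs.map Complex.reAddGroupHom Complex.continuous_re
    have hr : HasSum (fun n : ℕ => (t * (c - ε)) ^ n / n.factorial * (q ρ).re)
        (Real.exp (t * (c - ε)) * (q ρ).re) := by
      have := (NormedSpace.expSeries_div_hasSum_exp (𝔸 := ℝ) (t * (c - ε))).mul_right (q ρ).re
      rwa [← Real.exp_eq_exp_ℝ] at this
    have hle : (q (expMap ((t : ℂ) • E) ρ)).re ≤ Real.exp (t * (c - ε)) * (q ρ).re := by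
      refine hasSum_le (fun n => ?_) hs' hr
      simp only [Function.comp, Complex.coe_reAddGroupHom, map_smul, smul_pow,
        LinearMap.smul_apply, smul_eq_mul]
      have h1 : ((n.factorial : ℂ)⁻¹ * ((t : ℂ) ^ n * q ((E ^ n) ρ))).re =
          t ^ n / n.factorial * (q ((E ^ n) ρ)).re := by
        have : (n.factorial : ℂ)⁻¹ * ((t : ℂ) ^ n * q ((E ^ n) ρ)) =
            ((t ^ n / n.factorial : ℝ) : ℂ) * q ((E ^ n) ρ) := by
          push_cast; ring
        rw [this, Complex.re_ofReal_mul]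
      rw [h1]
      calc _ ≤ t ^ n / n.factorial * ((c - ε) ^ n * (q ρ).re) :=
            mul_le_mul_of_nonneg_left (hpow n).2 (by positivity)
        _ = _ := by rw [mul_pow]; ring
    rw [hexp, map_smul, smul_eq_mul, Complex.re_ofReal_mul]
    calc _ ≤ Real.exp (-(t * c)) * (Real.exp (t * (c - ε)) * (q ρ).re) :=
          mul_le_mul_of_nonneg_left hle (Real.exp_nonneg _)
      _ = _ := by rw [← mul_assoc, ← Real.exp_add]; ring_nf
  have hdens : ∀ t : ℝ, 0 ≤ t → IsDensity (expMap ((t : ℂ) • G) ρ) := by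
    intro t ht
    refine ⟨?_, ?_⟩
    · rw [hexp]
      refine (posSemidef_expMap hEpos ht hρ.1).smul ?_
      exact_mod_cast (Real.exp_nonneg _)
    · have hs := (hasSum_expMap ((t : ℂ) • G) ρ).map (traceLinearMap ι ℂ ℂ)
        (LinearMap.continuous_of_finiteDimensional _)
      refine hs.unique ?_
      convert hasSum_single 0 ?_ using 1
      · simp [hρ.2]
      · intro n hn
        obtain ⟨k, rfl⟩ := Nat.exists_eq_succ_of_ne_zero hn
        simp [pow_succ', htr]
  refine tendsto_pi_nhds.2 fun i => tendsto_pi_nhds.2 fun j => ?_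
  rw [tendsto_iff_norm_sub_tendsto_zero]
  have hlim : Tendsto (fun t : ℝ => √(2 * (Real.exp (-(t * ε)) * (q ρ).re))) atTop (𝓝 0) := by
    have h1 : Tendsto (fun t : ℝ => Real.exp (-(t * ε))) atTop (𝓝 0) :=
      Real.tendsto_exp_neg_atTop_nhds_zero.comp (tendsto_id.atTop_mul_const hε)
    have h2 := ((h1.mul_const (q ρ).re).const_mul 2).sqrt
    simpa using h2
  refine squeeze_zero' (Eventually.of_forall fun t => norm_nonneg _) ?_ hlim
  filter_upwards [eventually_ge_atTop 0] with t ht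
  refine Real.le_sqrt_of_sq_le ?_
  refine (norm_sub_pureDensity_sq_le hψ (hdens t ht) i j).trans ?_
  exact mul_le_mul_of_nonneg_left (hsum t ht) zero_le_two

end Convergence

/-! ### A stability criterion for Lindblad generators -/

section Criterion

variable {ι κ : Type*} [Fintype ι] [DecidableEq ι] [Fintype κ]

theorem exists_sub_smul_one_posSemidef {A : Matrix ι ι ℂ} (hA : A.PosDef) {c : ℝ}
    (hc : 0 < c) : ∃ ε : ℝ, 0 < ε ∧ ε ≤ c ∧ (A - (ε : ℂ) • 1).PosSemidef := by
  have hfin : ∃ ε : ℝ, 0 < ε ∧ ε ≤ c ∧ ∀ i, ε ≤ hA.isHermitian.eigenvalues i := by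
    cases isEmpty_or_nonempty ι
    · exact ⟨c, hc, le_rfl, fun i => isEmptyElim i⟩
    · obtain ⟨i, hi⟩ := Finite.exists_min hA.isHermitian.eigenvalues
      exact ⟨_, lt_min (hA.eigenvalues_pos i) hc, min_le_right _ _,
        fun j => (min_le_left _ _).trans (hi j)⟩
  obtain ⟨ε, hε, hεc, hle⟩ := hfin
  refine ⟨ε, hε, hεc, posSemidef_iff_isHermitian_and_spectrum_nonneg.2 ⟨?_, ?_⟩⟩
  · refine hA.isHermitian.sub ?_
    rw [IsHermitian, conjTranspose_smul, conjTranspose_one, Complex.star_def, Complex.conj_ofReal]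
  · intro z hz
    have hz' : z + ε ∈ spectrum ℂ A := by
      have h := spectrum.add_mem_add_iff (r := z) (s := (ε : ℂ)) (a := A - (ε : ℂ) • 1)
      rw [Algebra.algebraMap_eq_smul_one, add_sub_cancel] at h
      exact h.2 hz
    rw [hA.isHermitian.spectrum_eq_image_range] at hz'
    obtain ⟨_, ⟨i, rfl⟩, hi⟩ := hz'
    have : z = ((hA.isHermitian.eigenvalues i - ε : ℝ) : ℂ) := by
      rw [Complex.ofReal_sub]
      exact eq_sub_of_add_eq hi.symm
    rw [this]
    show (0 : ℂ) ≤ _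
    exact_mod_cast sub_nonneg.2 (hle i)

/-- A positive semidefinite matrix whose kernel is the line through `ψ` dominates a multiple of the
projection onto the orthogonal complement of `ψ`. -/
theorem exists_sub_smul_one_sub_pureDensity_posSemidef {ψ : EuclideanSpace ℂ ι} (hψ : ‖ψ‖ = 1)
    {A : Matrix ι ι ℂ} (hA : A.PosSemidef) (hAψ : A *ᵥ ψ.ofLp = 0)
    (hker : ∀ x : ι → ℂ, A *ᵥ x = 0 → ∃ z : ℂ, x = z • ψ.ofLp)
    {c : ℝ} (hc : 0 < c) : ∃ ε : ℝ, 0 < ε ∧ ε ≤ c ∧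
    (A - (ε : ℂ) • (1 - pureDensity ψ)).PosSemidef := by
  set P := pureDensity ψ with hPdef
  have hP := pureDensity_posSemidef ψ
  have hPP : P * P = P := pureDensity_mul_self ψ hψ
  have hPH : Pᴴ = P := hP.isHermitian
  have hAP : A * P = 0 := by rw [hPdef, pureDensity, mul_vecMulVec, hAψ, zero_vecMulVec]
  have hPA : P * A = 0 := by
    have := congrArg conjTranspose hAP
    rwa [conjTranspose_mul, conjTranspose_zero, hPH, hA.isHermitian.eq] at this
  have hpd : (A + P).PosDef := by
    refine .of_dotProduct_mulVec_pos (hA.isHermitian.add hP.isHermitian) fun x hx => ?_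
    rw [add_mulVec, dotProduct_add]
    have h1 := hA.dotProduct_mulVec_nonneg x
    have h2 := hP.dotProduct_mulVec_nonneg x
    refine lt_of_le_of_ne (add_nonneg h1 h2) fun h0 => hx ?_
    have h3 := (add_eq_zero_iff_of_nonneg h1 h2).1 h0.symm
    obtain ⟨z, rfl⟩ := hker x ((hA.dotProduct_mulVec_zero_iff x).1 h3.1)
    have h4 := (hP.dotProduct_mulVec_zero_iff _).1 h3.2
    rw [pureDensity, mulVec_smul, vecMulVec_mulVec, star_dotProduct_self ψ hψ] at h4
    simpa using h4
  obtain ⟨ε, hε, hεc, h⟩ := exists_sub_smul_one_posSemidef hpd hc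
  refine ⟨ε, hε, hεc, ?_⟩
  -- compressing `A + P - ε` to the orthogonal complement of `ψ` gives `A - ε (1 - P)`
  have h2 := h.mul_mul_conjTranspose_same (1 - P)
  convert h2 using 1
  rw [conjTranspose_sub, conjTranspose_one, hPH]
  simp only [sub_mul, mul_sub, add_mul, mul_add, one_mul, mul_one, smul_mul_assoc, mul_smul_comm,
    hAP, hPA, hPP, smul_sub, zero_mul]
  abel

theorem lindbladian_zero_apply (L : κ → Matrix ι ι ℂ) (ρ : Matrix ι ι ℂ) :
    lindbladian 0 L ρ = ∑ k, (L k * ρ * (L k)ᴴ -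
      (1 / 2 : ℂ) • ((L k)ᴴ * L k * ρ + ρ * ((L k)ᴴ * L k))) := by
  simp [lindbladian, mul_assoc]

theorem trace_lindbladian (L : κ → Matrix ι ι ℂ) (ρ : Matrix ι ι ℂ) :
    (lindbladian 0 L ρ).trace = 0 := by
  rw [lindbladian_zero_apply, trace_sum]
  refine Finset.sum_eq_zero fun k _ => ?_
  have h1 : (L k * ρ * (L k)ᴴ).trace = ((L k)ᴴ * L k * ρ).trace := by
    rw [trace_mul_comm, mul_assoc]
  rw [trace_sub, trace_smul, trace_add, trace_mul_comm ρ, h1, smul_eq_mul]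
  ring

/-- The vectors `(L k)ᴴ ψ` span the orthogonal complement of `ψ` when no vector independent of `ψ`
is orthogonal to all of them. Then the dissipator pumps every state into `ψ` at a positive rate. -/
theorem isGAS_lindbladian {ψ : EuclideanSpace ℂ ι} (hψ : ‖ψ‖ = 1) (L : κ → Matrix ι ι ℂ)
    {c : ℝ} (hc : 0 < c)
    (hpos : ∀ ρ : Matrix ι ι ℂ, ρ.PosSemidef → (lindbladian 0 L ρ + (c : ℂ) • ρ).PosSemidef)
    (hL : ∀ k, L k *ᵥ ψ.ofLp = 0)
    (hker : ∀ x : ι → ℂ, (∀ k, star ψ.ofLp ⬝ᵥ (L k *ᵥ x) = 0) → ∃ z : ℂ, x = z • ψ.ofLp) :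
    IsGAS (lindbladian 0 L) (pureDensity ψ) := by
  set P := pureDensity ψ with hPdef
  have hPpos : P.PosSemidef := pureDensity_posSemidef ψ
  have hPH : Pᴴ = P := hPpos.isHermitian
  have hLP : ∀ k, L k * P = 0 := fun k => by
    rw [hPdef, pureDensity, mul_vecMulVec, hL, zero_vecMulVec]
  have hPL : ∀ k, P * (L k)ᴴ = 0 := fun k => by
    have := congrArg conjTranspose (hLP k)
    rwa [conjTranspose_mul, conjTranspose_zero, hPH] at this
  set D : Matrix ι ι ℂ := ∑ k, (L k)ᴴ * P * L k with hD
  have hDk : ∀ k, ((L k)ᴴ * P * L k).PosSemidef := fun k => hPpos.conjTranspose_mul_mul_same (L k)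
  have hDpos : D.PosSemidef := posSemidef_sum _ fun k _ => hDk k
  have hDψ : D *ᵥ ψ.ofLp = 0 := by
    rw [hD, sum_mulVec]
    exact Finset.sum_eq_zero fun k _ => by rw [← mulVec_mulVec, hL, mulVec_zero]
  have hDker : ∀ x : ι → ℂ, D *ᵥ x = 0 → ∃ z : ℂ, x = z • ψ.ofLp := by
    intro x hx
    refine hker x fun k => ?_
    have h1 := (hDpos.dotProduct_mulVec_zero_iff x).2 hx
    rw [hD, sum_mulVec, dotProduct_sum] at h1
    have h2 := (Finset.sum_eq_zero_iff_of_nonneg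
      fun k _ => (hDk k).dotProduct_mulVec_nonneg x).1 h1 k (Finset.mem_univ k)
    have h3 : P *ᵥ (L k *ᵥ x) = 0 := by
      refine (hPpos.dotProduct_mulVec_zero_iff _).1 ?_
      rw [star_mulVec, ← dotProduct_mulVec, mulVec_mulVec, mulVec_mulVec]
      exact h2
    have h4 := congrArg (fun y => star ψ.ofLp ⬝ᵥ y) h3
    rw [hPdef, pureDensity, vecMulVec_mulVec] at h4
    simpa [star_dotProduct_self ψ hψ] using h4
  obtain ⟨ε, hε, hεc, hDε⟩ :=
    exists_sub_smul_one_sub_pureDensity_posSemidef hψ hDpos hDψ hDker hc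
  refine isGAS_of_infidelity_decay hψ _ hε hεc hpos
    (trace_lindbladian L) ?_ ?_
  · rw [lindbladian_zero_apply]
    refine Finset.sum_eq_zero fun k _ => ?_
    rw [hLP, mul_assoc, hLP, ← mul_assoc P, hPL]
    simp
  · intro ρ hρ
    have h1 : (P * lindbladian 0 L ρ).trace = (D * ρ).trace := by
      rw [lindbladian_zero_apply, hD, Finset.mul_sum, Finset.sum_mul, trace_sum, trace_sum]
      refine Finset.sum_congr rfl fun k _ => ?_
      have h2 : P * ((L k)ᴴ * L k * ρ) = 0 := by
        rw [mul_assoc, ← mul_assoc P, hPL, zero_mul]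
      have h3 : (P * (ρ * ((L k)ᴴ * L k))).trace = 0 := by
        rw [trace_mul_comm, mul_assoc, mul_assoc, hLP, mul_zero, mul_zero, trace_zero]
      rw [mul_sub, trace_sub, mul_smul_comm, mul_add, h2, zero_add, trace_smul, h3, smul_zero,
        sub_zero, ← mul_assoc, trace_mul_comm, ← mul_assoc, ← mul_assoc]
    have h2 := (Complex.le_def.1 (trace_mul_nonneg hDε hρ)).1
    rw [sub_mul, trace_sub, smul_mul_assoc, trace_smul, smul_eq_mul, Complex.sub_re,
      Complex.re_ofReal_mul, Complex.zero_re] at h2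
    rw [sub_mul, one_mul, trace_sub, trace_lindbladian, h1, zero_sub, Complex.neg_re]
    linarith

end Criterion

/-! ### Stabilizability and the subspace `H₀` -/

section Pumping

variable {ι α β : Type*}

/-- The operator `X ⊗ I`. -/
def extendOp [DecidableEq β] (e : ι ≃ α × β) : Matrix α α ℂ →ₗ[ℂ] Matrix ι ι ℂ where
  toFun X := (X ⊗ₖ (1 : Matrix β β ℂ)).submatrix e e
  map_add' X Y := by rw [add_kronecker]; rfl
  map_smul' z X := by rw [smul_kronecker]; rfl

theorem extendOp_mul [Fintype ι] [Fintype α] [Fintype β] [DecidableEq β] (e : ι ≃ α × β)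
    (X Y : Matrix α α ℂ) :
    extendOp e (X * Y) = extendOp e X * extendOp e Y := by
  show (_ ⊗ₖ _).submatrix e e = (_ ⊗ₖ _).submatrix e e * (_ ⊗ₖ _).submatrix e e
  rw [submatrix_mul_equiv, ← mul_kronecker_mul, one_mul]

theorem extendOp_conjTranspose [DecidableEq β] (e : ι ≃ α × β) (X : Matrix α α ℂ) :
    (extendOp e X)ᴴ = extendOp e Xᴴ := by
  show ((_ ⊗ₖ _).submatrix e e)ᴴ = (_ ⊗ₖ _).submatrix e e
  rw [conjTranspose_submatrix, conjTranspose_kronecker, conjTranspose_one]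

theorem coeffMatrix_extendOp [Fintype ι] [Fintype α] [DecidableEq α] [Fintype β] [DecidableEq β]
    (e : ι ≃ α × β) (X : Matrix α α ℂ) (x : ι → ℂ) :
    coeffMatrix e (WithLp.toLp 2 (extendOp e X *ᵥ x)) = X * coeffMatrix e (WithLp.toLp 2 x) :=
  coeffMatrix_mulVec e X (WithLp.toLp 2 x)

theorem star_dotProduct_eq_trace [Fintype ι] [Fintype α] [Fintype β] (e : ι ≃ α × β)
    (v w : EuclideanSpace ℂ ι) :
    star v.ofLp ⬝ᵥ w.ofLp = ((coeffMatrix e v)ᴴ * coeffMatrix e w).trace := by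
  simp only [trace, diag_apply, mul_apply, conjTranspose_apply, coeffMatrix_apply, dotProduct,
    Pi.star_apply]
  rw [Finset.sum_comm, ← Fintype.sum_prod_type', ← Equiv.sum_comp e.symm]

/-- The orthogonal projection onto the orthogonal complement of the column space of `V`. -/
theorem exists_projection_ker_eq_range [Fintype α] [DecidableEq α] [Fintype β] [DecidableEq β]
    (V : Matrix α β ℂ) :
    ∃ F : Matrix α α ℂ, Fᴴ = F ∧ F * F = F ∧ F * V = 0 ∧
      ∀ x : α → ℂ, F *ᵥ x = 0 → ∃ y, x = V *ᵥ y := by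
  let U : Submodule ℂ (EuclideanSpace ℂ α) :=
    (LinearMap.range V.mulVecLin).comap (WithLp.linearEquiv 2 ℂ (α → ℂ)).toLinearMap
  obtain ⟨F, hF⟩ : ∃ F : Matrix α α ℂ,
      toEuclideanCLM (n := α) (𝕜 := ℂ) F = Uᗮ.starProjection :=
    (toEuclideanCLM (n := α) (𝕜 := ℂ)).surjective _
  have happ : ∀ x : α → ℂ, F *ᵥ x = (Uᗮ.starProjection (WithLp.toLp 2 x)).ofLp := by
    intro x
    rw [← hF, toEuclideanCLM_toLp]
  refine ⟨F, ?_, ?_, ?_, ?_⟩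
  · apply (toEuclideanCLM (n := α) (𝕜 := ℂ)).injective
    change toEuclideanCLM (n := α) (𝕜 := ℂ) Fᴴ = toEuclideanCLM (n := α) (𝕜 := ℂ) F
    rw [← star_eq_conjTranspose, map_star, hF]
    exact isSelfAdjoint_starProjection Uᗮ
  · apply (toEuclideanCLM (n := α) (𝕜 := ℂ)).injective
    change toEuclideanCLM (n := α) (𝕜 := ℂ) (F * F) = toEuclideanCLM (n := α) (𝕜 := ℂ) F
    rw [map_mul, hF]
    exact Uᗮ.isIdempotentElem_starProjection
  · ext i j
    have h := happ (V.col j)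
    rw [(Submodule.starProjection_apply_eq_zero_iff _).2] at h
    · exact congrFun h i
    · rw [Submodule.orthogonal_orthogonal]
      exact ⟨Pi.single j 1, by simp⟩
  · intro x hx
    rw [happ] at hx
    have h : Uᗮ.starProjection (WithLp.toLp 2 x) = 0 := by
      ext i; exact congrFun hx i
    rw [Submodule.starProjection_apply_eq_zero_iff, Submodule.orthogonal_orthogonal] at h
    obtain ⟨y, hy⟩ := h
    exact ⟨y, hy.symm⟩

/-- Lindblad operators on one neighborhood which empty the range of the projection `F`: the
projection itself, and the operators mapping it onto arbitrary basis vectors. -/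
def pumpOp [Fintype α] [DecidableEq α] [DecidableEq β] (e : ι ≃ α × β) (F : Matrix α α ℂ) : Option
    (α × α) → Matrix ι ι ℂ
  | none => extendOp e F
  | some (i, j) => extendOp e (single i j 1 * F)

theorem isNeighborhoodOp_pumpOp [Fintype α] [DecidableEq α] [DecidableEq β] (e : ι ≃ α × β)
    (F : Matrix α α ℂ) (k : Option (α × α)) :
    IsNeighborhoodOp e (pumpOp e F k) := by
  rcases k with _ | ⟨i, j⟩
  · exact ⟨_, rfl⟩
  · exact ⟨_, rfl⟩

theorem pumpOp_mulVec_eq_zero [Fintype ι] [Fintype α] [DecidableEq α] [Fintype β] [DecidableEq β]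
    {e : ι ≃ α × β} {F : Matrix α α ℂ} {ψ : EuclideanSpace ℂ ι}
    (hF : F * coeffMatrix e ψ = 0) (k : Option (α × α)) : pumpOp e F k *ᵥ ψ.ofLp = 0 := by
  have h : ∀ X : Matrix α α ℂ, X * coeffMatrix e ψ = 0 → extendOp e X *ᵥ ψ.ofLp = 0 := by
    intro X hX
    have h1 := coeffMatrix_extendOp e X ψ.ofLp
    rw [show X * coeffMatrix e (WithLp.toLp 2 ψ.ofLp) = 0 from hX, ← map_zero (coeffMatrix e)] at h1
    exact congrArg WithLp.ofLp (coeffMatrix_injective e h1)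
  rcases k with _ | ⟨i, j⟩
  · exact h _ hF
  · exact h _ (by rw [Matrix.mul_assoc, hF, Matrix.mul_zero])

/-- With `d = card α` and `g = (1 + d) / 2`, the generator built from `pumpOp e F` is a completely
positive map minus `g ^ 2`: in Kraus form, its operators are `g - F ⊗ I` and the operators moving
the range of `F`. -/
theorem posSemidef_lindbladian_pumpOp_add [Fintype ι] [DecidableEq ι] [Fintype α] [DecidableEq α]
    [Fintype β] [DecidableEq β] (e : ι ≃ α × β) {F : Matrix α α ℂ} (hF : Fᴴ = F)
    (hFF : F * F = F) {ρ : Matrix ι ι ℂ} (hρ : ρ.PosSemidef) :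
    (lindbladian 0 (pumpOp e F) ρ +
      ((((1 + Fintype.card α) / 2) ^ 2 : ℝ) : ℂ) • ρ).PosSemidef := by
  set R := extendOp e F with hR
  have hRH : Rᴴ = R := by rw [hR, extendOp_conjTranspose, hF]
  have hRR : R * R = R := by rw [hR, ← extendOp_mul, hFF]
  set g : ℂ := (1 + Fintype.card α) / 2 with hg
  have hgs : star g = g := by simp [hg]
  have hsum : ∑ k : α × α, (pumpOp e F (some k))ᴴ * pumpOp e F (some k) =
      (Fintype.card α : ℂ) • R := by
    have h1 : ∀ i j : α, (single i j (1 : ℂ) * F)ᴴ * (single i j 1 * F) = F * single j j 1 * F := by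
      intro i j
      rw [conjTranspose_mul, conjTranspose_single, hF, star_one, mul_assoc,
        ← mul_assoc (single j i 1), single_mul_single_same, one_mul, ← mul_assoc]
    have h2 : ∑ j : α, single j j (1 : ℂ) = 1 := by
      ext a b
      rw [Matrix.sum_apply, Finset.sum_eq_single a (fun c _ hc => by simp [hc]) (by simp)]
      simp [single_apply, one_apply]
    calc _ = ∑ i : α, ∑ j : α, extendOp e (F * single j j 1 * F) := by
          rw [Fintype.sum_prod_type]
          refine Finset.sum_congr rfl fun i _ => Finset.sum_congr rfl fun j _ => ?_
          show (extendOp e _)ᴴ * extendOp e _ = _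
          rw [extendOp_conjTranspose, ← extendOp_mul, h1]
      _ = _ := by
          rw [Finset.sum_const, ← map_sum, ← Finset.sum_mul, ← Finset.mul_sum, h2, mul_one, hFF,
            Finset.card_univ, Nat.cast_smul_eq_nsmul]
  have key : lindbladian 0 (pumpOp e F) ρ + ((((1 + Fintype.card α) / 2) ^ 2 : ℝ) : ℂ) • ρ =
      (g • 1 - R) * ρ * (g • 1 - R)ᴴ +
        ∑ k : α × α, pumpOp e F (some k) * ρ * (pumpOp e F (some k))ᴴ := by
    rw [lindbladian_zero_apply, Fintype.sum_option, Finset.sum_sub_distrib, ← Finset.smul_sum,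
      Finset.sum_add_distrib, ← Finset.sum_mul, ← Finset.mul_sum, hsum]
    rw [show pumpOp e F none = R from rfl, hRH, hRR, conjTranspose_sub, conjTranspose_smul,
      conjTranspose_one, hRH, hgs]
    have hg2 : ((((1 + Fintype.card α) / 2) ^ 2 : ℝ) : ℂ) = g * g := by
      rw [hg]; push_cast; ring
    have hd : (Fintype.card α : ℂ) = 2 * g - 1 := by rw [hg]; ring
    rw [hg2, hd]
    simp only [sub_mul, mul_sub, smul_mul_assoc, mul_smul_comm, one_mul, mul_one]
    module
  rw [key]
  exact (hρ.mul_mul_conjTranspose_same _).add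
    (posSemidef_sum _ fun k _ => hρ.mul_mul_conjTranspose_same _)

/-- If the reduced state on the complement has full rank, a vector orthogonal to all
`(pumpOp e F k)ᴴ ψ` lies in the extended Schmidt span. -/
theorem mem_extendedSchmidtSpan_of_pumpOp [Fintype ι] [Fintype α] [DecidableEq α] [Fintype β]
    [DecidableEq β] {e : ι ≃ α × β} {F : Matrix α α ℂ}
    {ψ : EuclideanSpace ℂ ι} (hF : ∀ x : α → ℂ, F *ᵥ x = 0 → ∃ y, x = coeffMatrix e ψ *ᵥ y)
    (hinj : Function.Injective (coeffMatrix e ψ).mulVec) {x : EuclideanSpace ℂ ι}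
    (hx : ∀ k, star ψ.ofLp ⬝ᵥ (pumpOp e F k *ᵥ x.ofLp) = 0) :
    x ∈ extendedSchmidtSpan e ψ := by
  set V := coeffMatrix e ψ with hV
  have h1 : F * coeffMatrix e x * Vᴴ = 0 := by
    ext j i
    have h2 := hx (some (i, j))
    rw [show (pumpOp e F (some (i, j)) *ᵥ x.ofLp) = (WithLp.toLp 2
      (extendOp e (single i j 1 * F) *ᵥ x.ofLp) : EuclideanSpace ℂ ι).ofLp from rfl,
      star_dotProduct_eq_trace e, coeffMatrix_extendOp, trace_mul_comm, Matrix.mul_assoc,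
      Matrix.mul_assoc, trace_single_mul, one_smul] at h2
    rw [Matrix.mul_assoc]
    exact h2
  have h2 : F * coeffMatrix e x = 0 := by
    have h3 := congrArg conjTranspose h1
    rw [conjTranspose_mul, conjTranspose_conjTranspose, conjTranspose_zero] at h3
    rw [← conjTranspose_eq_zero]
    ext i j
    have h4 : V *ᵥ ((F * coeffMatrix e x)ᴴ).col j = V *ᵥ 0 := by
      rw [mulVec_zero]
      ext k
      exact congrFun (congrFun h3 k) j
    exact congrFun (hinj h4) i
  have h3 : ∀ j, ∃ y, (coeffMatrix e x).col j = V *ᵥ y := by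
    intro j
    refine hF _ ?_
    ext k
    exact congrFun (congrFun h2 k) j
  choose y hy using h3
  refine mem_extendedSchmidtSpan.2 ⟨(of y)ᵀ, ?_⟩
  ext i j
  exact congrFun (hy j) i

/-- A neighborhood operator that annihilates `ψ` annihilates its extended Schmidt span. -/
theorem mulVec_eq_zero_of_isNeighborhoodOp [Fintype ι] [Fintype α] [DecidableEq α] [Fintype β]
    [DecidableEq β] {e : ι ≃ α × β} {M : Matrix ι ι ℂ}
    (hM : IsNeighborhoodOp e M) {ψ w : EuclideanSpace ℂ ι} (hMψ : M *ᵥ ψ.ofLp = 0)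
    (hw : w ∈ extendedSchmidtSpan e ψ) : M *ᵥ w.ofLp = 0 := by
  obtain ⟨X, rfl⟩ := hM
  obtain ⟨Y, hY⟩ := mem_extendedSchmidtSpan.1 hw
  have h1 : X * coeffMatrix e ψ = 0 := by
    rw [← coeffMatrix_mulVec, hMψ]; rfl
  have h2 := coeffMatrix_mulVec e X w
  rw [hY, ← Matrix.mul_assoc, h1, Matrix.zero_mul, ← map_zero (coeffMatrix e)] at h2
  exact congrArg WithLp.ofLp (coeffMatrix_injective e h2)

end Pumping

section Tripartite

variable {A B C : Type*} [Fintype A] [DecidableEq A] [Fintype B] [DecidableEq B]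
  [Fintype C] [DecidableEq C]

/-- If the reduced states on `c` and on `a` have full rank and `H₀(ψ)` is the line through `ψ`,
then `ψ` is stabilized by emptying the complements of both Schmidt spans. -/
theorem isDQLS_of_dqlsSubspace_le {ψ : EuclideanSpace ℂ (A × B × C)} (hψ : ‖ψ‖ = 1)
    (hAB : Function.Injective (coeffMatrix splitAB ψ).mulVec)
    (hBC : Function.Injective (coeffMatrix splitBC ψ).mulVec)
    (h : dqlsSubspace ψ ≤ Submodule.span ℂ {ψ}) : IsDQLS ψ := by
  obtain ⟨F₁, hH₁, hF₁, hV₁, hk₁⟩ := exists_projection_ker_eq_range (coeffMatrix splitAB ψ)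
  obtain ⟨F₂, hH₂, hF₂, hV₂, hk₂⟩ := exists_projection_ker_eq_range (coeffMatrix splitBC ψ)
  let κ := Option ((A × B) × (A × B)) ⊕ Option ((B × C) × (B × C))
  let f : Fin (Fintype.card κ) ≃ κ := (Fintype.equivFin κ).symm
  let L : κ → Matrix (A × B × C) (A × B × C) ℂ :=
    Sum.elim (pumpOp splitAB F₁) (pumpOp splitBC F₂)
  have hL : ∀ k, L k *ᵥ ψ.ofLp = 0 := by
    rintro (k | k)
    · exact pumpOp_mulVec_eq_zero hV₁ k
    · exact pumpOp_mulVec_eq_zero hV₂ k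
  refine ⟨Fintype.card κ, L ∘ f, fun k => ?_, fun k => hL _, ?_⟩
  · show IsNeighborhoodOp splitAB (L (f k)) ∨ IsNeighborhoodOp splitBC (L (f k))
    rcases f k with k | k
    · exact Or.inl (isNeighborhoodOp_pumpOp _ _ _)
    · exact Or.inr (isNeighborhoodOp_pumpOp _ _ _)
  · have hsplit : ∀ ρ, lindbladian 0 (L ∘ f) ρ =
        lindbladian 0 (pumpOp splitAB F₁) ρ + lindbladian 0 (pumpOp splitBC F₂) ρ := by
      intro ρ
      simp only [lindbladian_zero_apply]
      exact (Equiv.sum_comp f fun k => L k * ρ * (L k)ᴴ -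
        (1 / 2 : ℂ) • ((L k)ᴴ * L k * ρ + ρ * ((L k)ᴴ * L k))).trans (Fintype.sum_sum_type _)
    refine isGAS_lindbladian hψ (L ∘ f)
      (c := ((1 + Fintype.card (A × B)) / 2) ^ 2 + ((1 + Fintype.card (B × C)) / 2) ^ 2)
      (by positivity) (fun ρ hρ => ?_) (fun k => hL _) (fun x hx => ?_)
    · have h1 := posSemidef_lindbladian_pumpOp_add (splitAB (A := A) (B := B) (C := C)) hH₁ hF₁ hρ
      have h2 := posSemidef_lindbladian_pumpOp_add (splitBC (A := A) (B := B) (C := C)) hH₂ hF₂ hρ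
      have h3 := h1.add h2
      rw [hsplit, Complex.ofReal_add, add_smul, add_add_add_comm]
      exact h3
    · have hx' : ∀ k, star ψ.ofLp ⬝ᵥ (L k *ᵥ x) = 0 := fun k => by
        have := hx (f.symm k)
        rwa [Function.comp, Equiv.apply_symm_apply] at this
      have hmem : (WithLp.toLp 2 x : EuclideanSpace ℂ (A × B × C)) ∈ dqlsSubspace ψ :=
        ⟨mem_extendedSchmidtSpan_of_pumpOp hk₁ hAB fun k => hx' (Sum.inl k),
          mem_extendedSchmidtSpan_of_pumpOp hk₂ hBC fun k => hx' (Sum.inr k)⟩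
      obtain ⟨z, hz⟩ := Submodule.mem_span_singleton.1 (h hmem)
      exact ⟨z, congrArg WithLp.ofLp hz.symm⟩

/-- The admissible Lindblad operators annihilate all of `H₀(ψ)`, so every unit vector in it is
stationary. -/
theorem not_isDQLS_of_two_le_finrank {ψ : EuclideanSpace ℂ (A × B × C)}
    (h : 2 ≤ Module.finrank ℂ (dqlsSubspace ψ)) : ¬ IsDQLS ψ := by
  rintro ⟨m, L, hloc, hL, hG, hconv⟩
  have hLw : ∀ k, ∀ w ∈ dqlsSubspace ψ, L k *ᵥ w.ofLp = 0 := by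
    intro k w hw
    rcases hloc k with hk | hk
    · exact mulVec_eq_zero_of_isNeighborhoodOp hk (hL k) hw.1
    · exact mulVec_eq_zero_of_isNeighborhoodOp hk (hL k) hw.2
  have hstat : ∀ w ∈ dqlsSubspace ψ, ‖w‖ = 1 → pureDensity w = pureDensity ψ := by
    intro w hw hw1
    have hG0 : lindbladian 0 L (pureDensity w) = 0 := by
      rw [lindbladian_zero_apply]
      refine Finset.sum_eq_zero fun k _ => ?_
      have h1 : L k * pureDensity w = 0 := by
        rw [pureDensity, mul_vecMulVec, hLw k w hw, zero_vecMulVec]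
      have h2 : pureDensity w * (L k)ᴴ = 0 := by
        have := congrArg conjTranspose h1
        rwa [conjTranspose_mul, conjTranspose_zero,
          (pureDensity_posSemidef w).isHermitian.eq] at this
      rw [h1, mul_assoc _ (L k), h1, ← mul_assoc, h2]
      simp
    have hc := hconv (pureDensity w) ⟨pureDensity_posSemidef w, trace_pureDensity w hw1⟩
    have hconst : (fun t : ℝ => expMap ((t : ℂ) • lindbladian 0 L) (pureDensity w)) =
        fun _ => pureDensity w := by
      funext t
      exact expMap_apply_of_apply_eq_zero (by rw [LinearMap.smul_apply, hG0, smul_zero])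
    rw [hconst] at hc
    exact tendsto_nhds_unique tendsto_const_nhds hc
  let b := stdOrthonormalBasis ℂ (dqlsSubspace ψ)
  let i : Fin (Module.finrank ℂ (dqlsSubspace ψ)) := ⟨0, by omega⟩
  let j : Fin (Module.finrank ℂ (dqlsSubspace ψ)) := ⟨1, by omega⟩
  have hi : ‖(b i : EuclideanSpace ℂ (A × B × C))‖ = 1 := b.orthonormal.1 i
  have hj : ‖(b j : EuclideanSpace ℂ (A × B × C))‖ = 1 := b.orthonormal.1 j
  have hij : star (b j : EuclideanSpace ℂ (A × B × C)).ofLp ⬝ᵥ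
      (b i : EuclideanSpace ℂ (A × B × C)).ofLp = 0 := by
    have : inner ℂ (b j) (b i) = 0 := b.orthonormal.2 (show j ≠ i by simp [i, j])
    rw [Submodule.coe_inner, EuclideanSpace.inner_eq_star_dotProduct, dotProduct_comm] at this
    exact this
  have heq := (hstat _ (b i).2 hi).trans (hstat _ (b j).2 hj).symm
  have h2 := congrArg (fun M => M *ᵥ (b i : EuclideanSpace ℂ (A × B × C)).ofLp) heq
  simp only [pureDensity, vecMulVec_mulVec, hij, star_dotProduct_self _ hi] at h2
  have h3 : (b i : EuclideanSpace ℂ (A × B × C)) = 0 := by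
    ext k
    simpa using congrFun h2 k
  rw [h3] at hi
  simp at hi

end Tripartite

/-! ### Matrix pencils -/

section Pencil

variable {A B C : Type*}

/-- The matrix of coefficients of `ψ` with the label of the middle factor fixed. The family of
slices is the matrix pencil (for two labels) that encodes `ψ`. -/
def slice (b : B) : EuclideanSpace ℂ (A × B × C) →ₗ[ℂ] Matrix A C ℂ where
  toFun ψ := of fun a c => ψ (a, b, c)
  map_add' _ _ := rfl
  map_smul' _ _ := rfl

theorem slice_injective {v w : EuclideanSpace ℂ (A × B × C)} (h : ∀ b, slice b v = slice b w) :
    v = w := by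
  ext ⟨a, b, c⟩
  exact congrFun (congrFun (h b) a) c

/-- The vector with prescribed slices. -/
def ofSlices (M : B → Matrix A C ℂ) : EuclideanSpace ℂ (A × B × C) :=
  WithLp.toLp 2 fun i => M i.2.1 i.1 i.2.2

theorem slice_ofSlices (M : B → Matrix A C ℂ) (b : B) : slice b (ofSlices M) = M b := rfl

/-- `H₀(ψ)` in terms of slices: the operators `X` on `a` and `Y` on `c` give the same vector. -/
theorem mem_dqlsSubspace [Fintype A] [Fintype B] [Fintype C] {ψ w : EuclideanSpace ℂ (A × B × C)} :
    w ∈ dqlsSubspace ψ ↔ (∃ Y : Matrix C C ℂ, ∀ b, slice b w = slice b ψ * Y) ∧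
      ∃ X : Matrix A A ℂ, ∀ b, slice b w = X * slice b ψ := by
  refine and_congr (mem_extendedSchmidtSpan.trans ?_) (mem_extendedSchmidtSpan.trans ?_)
  · refine exists_congr fun Y => ⟨fun h b => ?_, fun h => ?_⟩
    · ext a c
      exact congrFun (congrFun h (a, b)) c
    · ext ⟨a, b⟩ c
      exact congrFun (congrFun (h b) a) c
  · constructor
    · rintro ⟨X, h⟩
      refine ⟨Xᵀ, fun b => ?_⟩
      ext a c
      refine (congrFun (congrFun h (b, c)) a).trans ?_
      rw [mul_apply, mul_apply]
      exact Finset.sum_congr rfl fun _ _ => mul_comm _ _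
    · rintro ⟨X, h⟩
      refine ⟨Xᵀ, ?_⟩
      ext ⟨b, c⟩ a
      refine (congrFun (congrFun (h b) a) c).trans ?_
      rw [mul_apply, mul_apply]
      exact Finset.sum_congr rfl fun _ _ => mul_comm _ _

theorem self_mem_dqlsSubspace [Fintype A] [Fintype B] [Fintype C]
    (ψ : EuclideanSpace ℂ (A × B × C)) : ψ ∈ dqlsSubspace ψ := by
  classical
  exact mem_dqlsSubspace.2 ⟨⟨1, by simp⟩, ⟨1, by simp⟩⟩

/-- The vector with slices `X * M b`, where `M b` are the slices of `ψ`. -/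
def leftAct [Fintype A] (ψ : EuclideanSpace ℂ (A × B × C)) :
    Matrix A A ℂ →ₗ[ℂ] EuclideanSpace ℂ (A × B × C) where
  toFun X := ofSlices fun b => X * slice b ψ
  map_add' X Y := slice_injective fun b => by
    rw [map_add, slice_ofSlices, slice_ofSlices, slice_ofSlices, Matrix.add_mul]
  map_smul' z X := slice_injective fun b => by
    rw [map_smul, slice_ofSlices, slice_ofSlices, RingHom.id_apply, Matrix.smul_mul]

theorem slice_leftAct [Fintype A] (ψ : EuclideanSpace ℂ (A × B × C)) (X : Matrix A A ℂ) (b : B) :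
    slice b (leftAct ψ X) = X * slice b ψ := rfl

/-- The Sylvester map of the pencil: its kernel consists of the pairs `(X, Y)` which intertwine all
slices of `ψ`. -/
def sylvester [Fintype A] [Fintype C] : EuclideanSpace ℂ (A × B × C) →ₗ[ℂ]
    Matrix A A ℂ × Matrix C C ℂ →ₗ[ℂ] (B → Matrix A C ℂ) :=
  LinearMap.mk₂ ℂ (fun ψ Z b => Z.1 * slice b ψ - slice b ψ * Z.2)
    (fun ψ φ Z => by
      funext b; simp only [map_add, Matrix.mul_add, Matrix.add_mul, Pi.add_apply]; abel)
    (fun z ψ Z => by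
      funext b; simp only [map_smul, Matrix.mul_smul, Matrix.smul_mul, Pi.smul_apply, smul_sub])
    (fun ψ Z W => by
      funext b
      simp only [Prod.fst_add, Prod.snd_add, Matrix.mul_add, Matrix.add_mul, Pi.add_apply]; abel)
    (fun z ψ Z => by
      funext b
      simp only [Prod.smul_fst, Prod.smul_snd, Matrix.mul_smul, Matrix.smul_mul, Pi.smul_apply,
        smul_sub])

theorem sylvester_apply [Fintype A] [Fintype C] (ψ : EuclideanSpace ℂ (A × B × C))
    (Z : Matrix A A ℂ × Matrix C C ℂ)
    (b : B) : sylvester ψ Z b = Z.1 * slice b ψ - slice b ψ * Z.2 := rfl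

/-- Row vectors times one slice of `ψ`. -/
def sliceVecMul [Fintype A] (b : B) : EuclideanSpace ℂ (A × B × C) →ₗ[ℂ] (A → ℂ) →ₗ[ℂ] (C → ℂ) :=
  LinearMap.mk₂ ℂ (fun ψ x => x ᵥ* slice b ψ)
    (fun ψ φ x => by rw [map_add, vecMul_add])
    (fun z ψ x => by rw [map_smul, vecMul_smul])
    (fun ψ x y => by rw [add_vecMul])
    (fun z ψ x => by rw [smul_vecMul])

/-- All slices of `ψ` times a column vector. -/
def slicesMulVec [Fintype C] : EuclideanSpace ℂ (A × B × C) →ₗ[ℂ] (C → ℂ) →ₗ[ℂ] (B → A → ℂ) :=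
  LinearMap.mk₂ ℂ (fun ψ y b => slice b ψ *ᵥ y)
    (fun ψ φ y => by funext b; rw [map_add, add_mulVec]; rfl)
    (fun z ψ y => by funext b; rw [map_smul, smul_mulVec]; rfl)
    (fun ψ x y => by funext b; rw [mulVec_add]; rfl)
    (fun z ψ y => by funext b; rw [mulVec_smul]; rfl)

theorem eq_zero_of_mul_slice_eq_zero [Fintype A] {ψ : EuclideanSpace ℂ (A × B × C)} {b : B}
    (h : Function.Injective (sliceVecMul b ψ)) {X : Matrix A A ℂ} (hX : X * slice b ψ = 0) :
    X = 0 := by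
  ext i j
  have : sliceVecMul b ψ (X i) = sliceVecMul b ψ 0 := by
    rw [map_zero]
    exact congrFun hX i
  exact congrFun (h this) j

theorem leftAct_injective [Fintype A] {ψ : EuclideanSpace ℂ (A × B × C)} {b : B}
    (h : Function.Injective (sliceVecMul b ψ)) : Function.Injective (leftAct ψ) := by
  rw [injective_iff_map_eq_zero]
  intro X hX
  refine eq_zero_of_mul_slice_eq_zero h ?_
  rw [← slice_leftAct, hX, map_zero]

theorem coeffMatrix_splitAB_mulVec_injective [Fintype C] {ψ : EuclideanSpace ℂ (A × B × C)}
    (h : Function.Injective (slicesMulVec ψ)) :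
    Function.Injective (coeffMatrix splitAB ψ).mulVec := by
  intro x y hxy
  apply h
  funext b a
  exact congrFun hxy (a, b)

theorem coeffMatrix_splitBC_mulVec_injective [Fintype A] {ψ : EuclideanSpace ℂ (A × B × C)} {b : B}
    (h : Function.Injective (sliceVecMul b ψ)) :
    Function.Injective (coeffMatrix splitBC ψ).mulVec := by
  intro x y hxy
  apply h
  funext c
  have h2 : ∀ z : A → ℂ, sliceVecMul b ψ z c = (coeffMatrix splitBC ψ *ᵥ z) (b, c) := fun z =>
    Finset.sum_congr rfl fun _ _ => mul_comm _ _
  rw [h2, h2, hxy]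

/-- If the reduced state on `c` has full rank, then `H₀(ψ)` is isomorphic to the kernel of the
Sylvester map. -/
theorem finrank_dqlsSubspace_eq_finrank_ker [Fintype A] [Fintype B] [Fintype C]
    {ψ : EuclideanSpace ℂ (A × B × C)} {b : B}
    (h₁ : Function.Injective (sliceVecMul b ψ)) (h₂ : Function.Injective (slicesMulVec ψ)) :
    Module.finrank ℂ (dqlsSubspace ψ) = Module.finrank ℂ (LinearMap.ker (sylvester ψ)) := by
  let f : LinearMap.ker (sylvester ψ) →ₗ[ℂ] EuclideanSpace ℂ (A × B × C) :=
    leftAct ψ ∘ₗ LinearMap.fst ℂ _ _ ∘ₗ (LinearMap.ker (sylvester ψ)).subtype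
  have hf : Function.Injective f := by
    rw [injective_iff_map_eq_zero]
    rintro ⟨⟨X, Y⟩, hXY⟩ h0
    have hX : X = 0 := by
      apply leftAct_injective h₁
      rw [map_zero]
      exact h0
    subst hX
    have hY : ∀ b, slice b ψ * Y = 0 := by
      intro b
      have := congrFun (LinearMap.mem_ker.1 hXY) b
      rw [sylvester_apply] at this
      simpa using this
    have hY0 : Y = 0 := by
      ext i j
      have h3 : slicesMulVec ψ (Y.col j) = slicesMulVec ψ 0 := by
        rw [map_zero]
        funext b a
        exact congrFun (congrFun (hY b) a) j
      exact congrFun (h₂ h3) i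
    subst hY0
    rfl
  have hrange : LinearMap.range f = dqlsSubspace ψ := by
    ext w
    rw [mem_dqlsSubspace]
    constructor
    · rintro ⟨⟨⟨X, Y⟩, hXY⟩, rfl⟩
      refine ⟨⟨Y, fun b => ?_⟩, ⟨X, fun b => rfl⟩⟩
      exact sub_eq_zero.1 (congrFun (LinearMap.mem_ker.1 hXY) b)
    · rintro ⟨⟨Y, hY⟩, ⟨X, hX⟩⟩
      refine ⟨⟨(X, Y), ?_⟩, ?_⟩
      · rw [LinearMap.mem_ker]
        funext b
        rw [sylvester_apply, ← hX, ← hY, sub_self]; rfl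
      · exact slice_injective fun b => (hX b).symm
  rw [← hrange, LinearMap.finrank_range_of_inj hf]

/-- If the Schmidt span on `ab` is everything, then `H₀(ψ)` is the extended Schmidt span of
`bc`. -/
theorem finrank_dqlsSubspace_eq_sq [Fintype A] [Fintype B] [Fintype C]
    {ψ : EuclideanSpace ℂ (A × B × C)} {b : B}
    (h₁ : Function.Injective (sliceVecMul b ψ)) (h₂ : Function.Surjective (slicesMulVec ψ)) :
    Module.finrank ℂ (dqlsSubspace ψ) = Fintype.card A ^ 2 := by
  have hrange : LinearMap.range (leftAct ψ) = dqlsSubspace ψ := by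
    ext w
    rw [mem_dqlsSubspace]
    constructor
    · rintro ⟨X, rfl⟩
      refine ⟨?_, ⟨X, fun b => rfl⟩⟩
      choose y hy using fun j => h₂ fun b => (X * slice b ψ).col j
      refine ⟨(of y)ᵀ, fun b => ?_⟩
      ext i j
      exact (congrFun (congrFun (hy j) b) i).symm
    · rintro ⟨-, ⟨X, hX⟩⟩
      exact ⟨X, slice_injective fun b => (hX b).symm⟩
  rw [← hrange, LinearMap.finrank_range_of_inj (leftAct_injective h₁), Module.finrank_matrix,
    Module.finrank_self, mul_one, sq]

end Pencil

/-! ### The banded pencil -/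

section Band

/-- The vector whose slices are the two shift matrices `[I 0]` and `[0 I]` of size `m × n`. As a
representation of the Kronecker quiver it is a sum of `n - m` preprojective modules of nearly equal
dimension. -/
def bandVec (m n : ℕ) : EuclideanSpace ℂ (Fin m × Fin 2 × Fin n) :=
  ofSlices fun b => of fun i j => if (j : ℕ) = i + b * (n - m) then 1 else 0

theorem slice_bandVec {m n : ℕ} (b : Fin 2) (i : Fin m) (j : Fin n) :
    slice b (bandVec m n) i j = if (j : ℕ) = i + b * (n - m) then 1 else 0 := rfl

theorem slice_bandVec_mulVec {m n : ℕ} (b : Fin 2) (y : Fin n → ℂ) (i : Fin m) (j : Fin n)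
    (hj : (j : ℕ) = i + b * (n - m)) : (slice b (bandVec m n) *ᵥ y) i = y j := by
  rw [mulVec, dotProduct, Finset.sum_eq_single j]
  · rw [slice_bandVec, if_pos hj, one_mul]
  · intro l _ hl
    rw [slice_bandVec, if_neg, zero_mul]
    exact fun h => hl (Fin.ext (h.trans hj.symm))
  · simp

theorem sliceVecMul_bandVec_injective {m n : ℕ} (h : m < n) :
    Function.Injective (sliceVecMul 0 (bandVec m n)) := by
  rw [injective_iff_map_eq_zero]
  intro x hx
  ext i
  have h1 := congrFun hx ⟨i, i.2.trans h⟩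
  have h2 : sliceVecMul 0 (bandVec m n) x ⟨i, i.2.trans h⟩ = x i := by
    show (x ᵥ* slice 0 (bandVec m n)) _ = _
    rw [vecMul, dotProduct, Finset.sum_eq_single i]
    · rw [slice_bandVec, if_pos (by simp), mul_one]
    · intro l _ hl
      rw [slice_bandVec, if_neg, mul_zero]
      intro h
      exact hl (Fin.ext (by simpa using h.symm))
    · simp
  rw [← h2, h1]; rfl

theorem slicesMulVec_bandVec_injective {m n : ℕ} (h : m < n) (h2 : n ≤ 2 * m) :
    Function.Injective (slicesMulVec (bandVec m n)) := by
  rw [injective_iff_map_eq_zero]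
  intro y hy
  ext j
  by_cases hj : (j : ℕ) < m
  · rw [← slice_bandVec_mulVec 0 y ⟨j, hj⟩ j (by simp)]
    exact congrFun (congrFun hy 0) _
  · have hj2 := j.2
    rw [← slice_bandVec_mulVec 1 y (⟨j - (n - m), by omega⟩ : Fin m) j
      (by simp only [Fin.val_one, one_mul]; omega)]
    exact congrFun (congrFun hy 1) _

theorem slicesMulVec_bandVec_surjective {m n : ℕ} (h2 : 2 * m ≤ n) :
    Function.Surjective (slicesMulVec (bandVec m n)) := by
  intro w
  refine ⟨fun j => if h : (j : ℕ) < m then w 0 ⟨j, h⟩ else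
    if h' : (j : ℕ) - (n - m) < m then w 1 ⟨j - (n - m), h'⟩ else 0, ?_⟩
  funext b i
  have hi := i.2
  show (slice b (bandVec m n) *ᵥ _) i = _
  fin_cases b
  · rw [slice_bandVec_mulVec _ _ i ⟨i, by omega⟩ (by simp)]
    simp
  · rw [slice_bandVec_mulVec _ _ i ⟨i + (n - m), by omega⟩ (by simp)]
    have h3 : ¬ (i : ℕ) + (n - m) < m := by omega
    simp [h3]

/-- A linear functional vanishing on the range of the Sylvester map of `bandVec m (m + k)` is given
by two arrays `u`, `v` satisfying the relations `hX` and `hY`. They imply that `u` is invariant under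
the shift by `k` along the diagonals, and each diagonal runs into a region where `u` is zero. -/
theorem band_relations_eq_zero {m k : ℕ} (hk : 0 < k) (u v : ℕ → ℕ → ℂ)
    (hu : ∀ i j, m ≤ i → u i j = 0)
    (hX : ∀ i j, i < m → j < m → u i j + v i (j + k) = 0)
    (hY : ∀ i j, i < m + k → j < m + k → u i j + (if k ≤ i then v (i - k) j else 0) = 0) :
    (∀ i j, i < m → j < m + k → u i j = 0) ∧ ∀ i j, i < m → j < m + k → v i j = 0 := by
  have hshift : ∀ i j, i < m → j < m → u i j = u (i + k) (j + k) := by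
    intro i j hi hj
    have h1 := hX i j hi hj
    have h2 := hY (i + k) (j + k) (by omega) (by omega)
    rw [if_pos (by omega), Nat.add_sub_cancel] at h2
    exact add_right_cancel (h1.trans h2.symm)
  have hsmall : ∀ i j, i < k → i < m + k → j < m + k → u i j = 0 := by
    intro i j hi hi' hj
    have := hY i j hi' hj
    rwa [if_neg (by omega), add_zero] at this
  -- below the diagonal the shift leaves the band through the last rows
  have hlow : ∀ d i j, i + d = m → j ≤ i → u i j = 0 := by
    intro d
    induction d using Nat.strong_induction_on with
    | _ d ih =>
      intro i j hd hj
      by_cases hi : i < m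
      · rw [hshift i j hi (by omega)]
        by_cases hi2 : i + k < m
        · exact ih (d - k) (by omega) _ _ (by omega) (by omega)
        · exact hu _ _ (by omega)
      · exact hu _ _ (by omega)
  -- above the diagonal the shift leaves the band through the first rows
  have hup : ∀ i j, i < m → i < j → j < m + k → u i j = 0 := by
    intro i
    induction i using Nat.strong_induction_on with
    | _ i ih =>
      intro j hi hij hj
      by_cases hik : i < k
      · exact hsmall i j hik (by omega) hj
      · have := hshift (i - k) (j - k) (by omega) (by omega)
        rw [Nat.sub_add_cancel (by omega), Nat.sub_add_cancel (by omega)] at this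
        rw [← this]
        exact ih (i - k) (by omega) _ (by omega) (by omega) (by omega)
  have hu0 : ∀ i j, i < m → j < m + k → u i j = 0 := by
    intro i j hi hj
    by_cases hij : j ≤ i
    · exact hlow (m - i) i j (by omega) hij
    · exact hup i j hi (by omega) hj
  refine ⟨hu0, fun i j hi hj => ?_⟩
  have h1 := hY (i + k) j (by omega) hj
  rw [if_pos (by omega), Nat.add_sub_cancel] at h1
  by_cases hi2 : i + k < m
  · rwa [hu0 _ _ hi2 hj, zero_add] at h1
  · rwa [hu _ _ (by omega), zero_add] at h1

theorem single_mul_slice_bandVec {m n : ℕ} (b : Fin 2) (i i' : Fin m) (j : Fin n)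
    (hj : (j : ℕ) = i' + b * (n - m)) :
    single i i' (1 : ℂ) * slice b (bandVec m n) = single i j 1 := by
  ext r c
  by_cases hr : i = r
  · subst hr
    rw [single_mul_apply_same, slice_bandVec, one_mul, single_apply]
    refine if_congr ?_ rfl rfl
    rw [← hj, ← Fin.ext_iff]
    simp [eq_comm]
  · rw [single_mul_apply_of_ne _ _ _ _ _ (Ne.symm hr), single_apply, if_neg (fun h => hr h.1)]

theorem slice_bandVec_mul_single {m n : ℕ} (b : Fin 2) (i : Fin m) (j j' : Fin n)
    (hj : (j : ℕ) = i + b * (n - m)) :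
    slice b (bandVec m n) * single j j' (1 : ℂ) = single i j' 1 := by
  ext r c
  by_cases hc : j' = c
  · subst hc
    rw [mul_single_apply_same, slice_bandVec, mul_one, single_apply]
    refine if_congr ?_ rfl rfl
    rw [hj, Fin.ext_iff]
    omega
  · rw [mul_single_apply_of_ne _ _ _ _ _ (Ne.symm hc), single_apply, if_neg (fun h => hc h.2)]

theorem slice_bandVec_mul_single_eq_zero {m n : ℕ} (b : Fin 2) (j j' : Fin n)
    (hj : ∀ i : Fin m, (j : ℕ) ≠ i + b * (n - m)) :
    slice b (bandVec m n) * single j j' (1 : ℂ) = 0 := by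
  ext r c
  by_cases hc : j' = c
  · subst hc
    rw [mul_single_apply_same, slice_bandVec, if_neg (hj r), zero_mul]; rfl
  · rw [mul_single_apply_of_ne _ _ _ _ _ (Ne.symm hc)]; rfl

/-- The cokernel of the Sylvester map is trivial, that is, the pencil of `bandVec` has no
self-extensions. -/
theorem sylvester_bandVec_surjective {m n : ℕ} (h : m < n) :
    Function.Surjective (sylvester (bandVec m n)) := by
  obtain ⟨k, rfl⟩ := Nat.exists_eq_add_of_lt h
  obtain ⟨k, hk, hn⟩ : ∃ l, 0 < l ∧ m + k + 1 = m + l := ⟨k + 1, by omega, by omega⟩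
  rw [hn]
  clear hn h
  rw [← LinearMap.range_eq_top]
  by_contra hne
  obtain ⟨φ, hφ, hle⟩ := Submodule.exists_le_ker_of_lt_top _ (lt_top_iff_ne_top.2 hne)
  have hZ : ∀ Z, φ (sylvester (bandVec m (m + k)) Z) = 0 := fun Z => hle ⟨Z, rfl⟩
  let u : Fin 2 → ℕ → ℕ → ℂ := fun b i j =>
    if h : i < m ∧ j < m + k then φ (Pi.single b (single ⟨i, h.1⟩ ⟨j, h.2⟩ 1)) else 0
  have hu : ∀ b (i : Fin m) (j : Fin (m + k)), φ (Pi.single b (single i j 1)) = u b i j := by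
    intro b i j
    simp [u]
  have hφsum : ∀ Z : Fin 2 → Matrix (Fin m) (Fin (m + k)) ℂ,
      φ Z = φ (Pi.single 0 (Z 0)) + φ (Pi.single 1 (Z 1)) := by
    intro Z
    rw [← map_add]
    congr 1
    funext b
    fin_cases b <;> simp
  have hrel := band_relations_eq_zero (m := m) hk (u 0) (u 1)
    (fun i j hi => dif_neg (by omega)) ?_ ?_
  · apply hφ
    refine LinearMap.ext fun Z => ?_
    rw [hφsum, LinearMap.zero_apply]
    have : ∀ b, φ (Pi.single b (Z b)) = 0 := by
      intro b
      rw [matrix_eq_sum_single (Z b)]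
      have h1 : ∀ M : Matrix (Fin m) (Fin (m + k)) ℂ,
          φ (Pi.single b M) = (φ ∘ₗ LinearMap.single ℂ _ b) M := fun _ => rfl
      rw [h1, map_sum]
      refine Finset.sum_eq_zero fun i _ => ?_
      rw [map_sum]
      refine Finset.sum_eq_zero fun j _ => ?_
      have h2 : single i j (Z b i j) = Z b i j • single i j (1 : ℂ) := by
        rw [smul_single, smul_eq_mul, mul_one]
      rw [h2, map_smul, ← h1, hu]
      fin_cases b
      · simp [hrel.1 i j i.2 j.2]
      · simp [hrel.2 i j i.2 j.2]
    rw [this, this, add_zero]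
  · intro i j hi hj
    have h1 := hZ (single ⟨i, hi⟩ ⟨j, hj⟩ 1, 0)
    rw [hφsum, sylvester_apply, sylvester_apply, Matrix.mul_zero, Matrix.mul_zero, sub_zero,
      sub_zero, single_mul_slice_bandVec 0 _ _ ⟨j, by omega⟩ (by simp),
      single_mul_slice_bandVec 1 _ _ ⟨j + k, by omega⟩ (by simp), hu, hu] at h1
    exact h1
  · intro i j hi hj
    have h1 := hZ (0, single (⟨i, hi⟩ : Fin (m + k)) (⟨j, hj⟩ : Fin (m + k)) (1 : ℂ))
    rw [hφsum, sylvester_apply, sylvester_apply, Matrix.zero_mul, Matrix.zero_mul, zero_sub,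
      zero_sub] at h1
    have h2 : ∀ p q : Fin (m + k),
        φ (Pi.single 0 (-(slice 0 (bandVec m (m + k)) * single p q (1 : ℂ)))) = -u 0 p q := by
      intro p q
      rw [Pi.single_neg, map_neg]
      by_cases hpm : (p : ℕ) < m
      · rw [slice_bandVec_mul_single 0 ⟨p, hpm⟩ _ _ (by simp), hu]
      · rw [slice_bandVec_mul_single_eq_zero, Pi.single_zero, map_zero]
        · simp [u, hpm]
        · intro r
          have := r.2
          simp only [Fin.val_zero, zero_mul, add_zero]
          omega
    have h3 : ∀ p q : Fin (m + k),
        φ (Pi.single 1 (-(slice 1 (bandVec m (m + k)) * single p q (1 : ℂ)))) =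
          -(if k ≤ (p : ℕ) then u 1 (p - k) q else 0) := by
      intro p q
      rw [Pi.single_neg, map_neg]
      by_cases hpk : k ≤ (p : ℕ)
      · rw [slice_bandVec_mul_single 1 (⟨p - k, by omega⟩ : Fin m) _ _
          (by simp only [Fin.val_one, one_mul]; omega), hu, if_pos hpk]
      · rw [slice_bandVec_mul_single_eq_zero, Pi.single_zero, map_zero, if_neg hpk, neg_zero]
        intro r
        simp only [Fin.val_one, one_mul]
        omega
    rw [h2, h3, ← neg_add, neg_eq_zero] at h1
    exact h1

end Band

/-! ### Square pencils and the generic dimensions -/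

section Square

/-- If the only matrix that commutes with `N` and annihilates `e` is zero, then every vector is the
image of `e` under a matrix commuting with `N`. Otherwise `N` has a left eigenvector `y` that
annihilates all those images, and `x yᵀ` with a right eigenvector `x` for the same eigenvalue
commutes with `N` and annihilates `e`. -/
theorem exists_commute_mulVec_eq {m : Type*} [Fintype m] [DecidableEq m] (N : Matrix m m ℂ)
    (e : m → ℂ) (h : ∀ X : Matrix m m ℂ, X * N = N * X → X *ᵥ e = 0 → X = 0) (v : m → ℂ) :
    ∃ X : Matrix m m ℂ, X * N = N * X ∧ X *ᵥ e = v := by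
  let S : Submodule ℂ (m → ℂ) :=
    { carrier := {v | ∃ X : Matrix m m ℂ, X * N = N * X ∧ X *ᵥ e = v}
      add_mem' := by
        rintro _ _ ⟨X, hX, rfl⟩ ⟨Y, hY, rfl⟩
        exact ⟨X + Y, by rw [add_mul, mul_add, hX, hY], add_mulVec _ _ _⟩
      zero_mem' := ⟨0, by simp, zero_mulVec _⟩
      smul_mem' := by
        rintro z _ ⟨X, hX, rfl⟩
        exact ⟨z • X, by rw [smul_mul_assoc, mul_smul_comm, hX], smul_mulVec _ _ _⟩ }
  suffices hS : S = ⊤ by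
    have : v ∈ S := hS ▸ Submodule.mem_top
    exact this
  by_contra hne
  -- the left annihilator of `S`, which is invariant under `Nᵀ`
  let W : Submodule ℂ (m → ℂ) :=
    { carrier := {y | ∀ s ∈ S, y ⬝ᵥ s = 0}
      add_mem' := fun {y z} hy hz s hs => by rw [add_dotProduct, hy s hs, hz s hs, add_zero]
      zero_mem' := fun s _ => zero_dotProduct s
      smul_mem' := fun z y hy s hs => by rw [smul_dotProduct, hy s hs, smul_zero] }
  have hW : ∀ y ∈ W, Nᵀ.mulVecLin y ∈ W := by
    rintro y hy _ ⟨X, hX, rfl⟩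
    rw [mulVecLin_apply, mulVec_transpose, ← dotProduct_mulVec]
    refine hy _ ⟨N * X, ?_, ?_⟩
    · rw [mul_assoc, hX]
    · rw [mulVec_mulVec]
  obtain ⟨f, hf, hle⟩ := Submodule.exists_le_ker_of_lt_top S (lt_top_iff_ne_top.2 hne)
  have hfy : ∀ s, (fun i => f (Pi.single i 1)) ⬝ᵥ s = f s := by
    intro s
    conv_rhs => rw [pi_eq_sum_univ' s, map_sum]
    rw [dotProduct]
    refine Finset.sum_congr rfl fun i _ => ?_
    rw [map_smul, smul_eq_mul, mul_comm]
  have hWne : Nontrivial W := by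
    rw [Submodule.nontrivial_iff_ne_bot, Submodule.ne_bot_iff]
    refine ⟨fun i => f (Pi.single i 1), fun s hs => (hfy s).trans (hle hs), fun h0 => hf ?_⟩
    ext s
    rw [LinearMap.comp_apply, ← hfy, h0, zero_dotProduct]
    rfl
  obtain ⟨μ, hμ⟩ := Module.End.exists_eigenvalue (Nᵀ.mulVecLin.restrict hW)
  obtain ⟨⟨y, hyW⟩, hy⟩ := hμ.exists_hasEigenvector
  have hyN : y ᵥ* N = μ • y := by
    rw [← mulVec_transpose]
    exact congrArg Subtype.val hy.apply_eq_smul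
  have hy0 : y ≠ 0 := fun h0 => hy.2 (Subtype.ext h0)
  have hdet : (N - μ • (1 : Matrix m m ℂ)).det = 0 :=
    exists_vecMul_eq_zero_iff.1 ⟨y, hy0, by rw [vecMul_sub, hyN, vecMul_smul, vecMul_one, sub_self]⟩
  obtain ⟨x, hx0, hx⟩ := exists_mulVec_eq_zero_iff.2 hdet
  rw [sub_mulVec, smul_mulVec, one_mulVec, sub_eq_zero] at hx
  have hX := h (vecMulVec x y)
    (by rw [vecMulVec_mul, mul_vecMulVec, hx, hyN, vecMulVec_smul, smul_vecMulVec])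
    (by rw [vecMulVec_mulVec, hyW e ⟨1, by simp, one_mulVec _⟩]; simp)
  obtain ⟨i, hi⟩ := Function.ne_iff.1 hx0
  obtain ⟨j, hj⟩ := Function.ne_iff.1 hy0
  exact mul_ne_zero hi hj (congrFun (congrFun hX i) j)

variable {m : ℕ}

/-- The Sylvester map together with the value of `X` on the vector `M₀ (1, …, 1)`. The vector is
chosen so that the family is linear in `ψ`. -/
def cyclicMap : EuclideanSpace ℂ (Fin m × Fin 2 × Fin m) →ₗ[ℂ]
    Matrix (Fin m) (Fin m) ℂ × Matrix (Fin m) (Fin m) ℂ →ₗ[ℂ]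
      (Fin 2 → Matrix (Fin m) (Fin m) ℂ) × (Fin m → ℂ) :=
  LinearMap.mk₂ ℂ (fun ψ Z => (sylvester ψ Z, (Z.1 * slice 0 ψ) *ᵥ 1))
    (fun ψ φ Z => by
      rw [map_add, LinearMap.add_apply, map_add, Matrix.mul_add, add_mulVec, Prod.mk_add_mk])
    (fun z ψ Z => by
      rw [map_smul, LinearMap.smul_apply, map_smul, Matrix.mul_smul, smul_mulVec, Prod.smul_mk])
    (fun ψ Z W => by
      rw [map_add, Prod.fst_add, Matrix.add_mul, add_mulVec, Prod.mk_add_mk])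
    (fun z ψ Z => by
      rw [map_smul, Prod.smul_fst, Matrix.smul_mul, smul_mulVec, Prod.smul_mk])

/-- The vector whose slices are the identity and a diagonal matrix with distinct entries. -/
def diagVec (m : ℕ) : EuclideanSpace ℂ (Fin m × Fin 2 × Fin m) :=
  ofSlices ![1, diagonal fun i => ((i : ℕ) : ℂ)]

/-- A matrix commuting with a diagonal matrix with distinct entries is diagonal, and a diagonal
matrix annihilating `(1, …, 1)` is zero. -/
theorem cyclicMap_diagVec_injective : Function.Injective (cyclicMap (diagVec m)) := by
  rw [injective_iff_map_eq_zero]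
  rintro ⟨X, Y⟩ h
  have h0 : X * 1 - 1 * Y = 0 := congrFun (congrArg Prod.fst h) 0
  have h1 : X * diagonal (fun i : Fin m => ((i : ℕ) : ℂ)) -
      diagonal (fun i : Fin m => ((i : ℕ) : ℂ)) * Y = 0 := congrFun (congrArg Prod.fst h) 1
  have h2 : (X * 1) *ᵥ 1 = 0 := congrArg Prod.snd h
  rw [mul_one, one_mul, sub_eq_zero] at h0
  subst h0
  have hoff : ∀ i j, i ≠ j → X i j = 0 := by
    intro i j hij
    have h3 := congrFun (congrFun h1 i) j
    rw [Matrix.sub_apply, mul_diagonal, diagonal_mul, mul_comm, ← sub_mul] at h3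
    refine (mul_eq_zero.1 h3).resolve_left (sub_ne_zero.2 fun h4 => hij ?_)
    exact Fin.ext (by exact_mod_cast h4.symm)
  have hdiag : ∀ i, X i i = 0 := by
    intro i
    have h3 := congrFun h2 i
    rw [mul_one, mulVec, dotProduct, Finset.sum_eq_single i (fun j _ hj => by
      rw [hoff i j hj.symm, zero_mul]) (by simp)] at h3
    simpa using h3
  have hX : X = 0 := by
    ext i j
    by_cases hij : i = j
    · subst hij; exact hdiag i
    · exact hoff i j hij
  rw [hX]; rfl

theorem sliceVecMul_diagVec_injective : Function.Injective (sliceVecMul 0 (diagVec m)) := by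
  intro x y h
  have h2 : x ᵥ* (1 : Matrix (Fin m) (Fin m) ℂ) = y ᵥ* 1 := h
  rwa [vecMul_one, vecMul_one] at h2

/-- When the two slices are square, `H₀(ψ)` is isomorphic to the commutant of `M₁ M₀⁻¹`, which is
generically isomorphic to the space of vectors by evaluation at `M₀ (1, …, 1)`. -/
theorem finrank_dqlsSubspace_of_square {ψ : EuclideanSpace ℂ (Fin m × Fin 2 × Fin m)}
    (h₀ : Function.Injective (sliceVecMul 0 ψ)) (h₁ : Function.Injective (cyclicMap ψ)) :
    Module.finrank ℂ (dqlsSubspace ψ) = m := by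
  set M := slice 0 ψ with hM
  have hunit : IsUnit M := vecMul_injective_iff_isUnit.1 h₀
  have hMM : M * M⁻¹ = 1 := mul_nonsing_inv M ((isUnit_iff_isUnit_det M).1 hunit)
  have hMM' : M⁻¹ * M = 1 := nonsing_inv_mul M ((isUnit_iff_isUnit_det M).1 hunit)
  set N := slice 1 ψ * M⁻¹ with hN
  have hNM : N * M = slice 1 ψ := by rw [hN, mul_assoc, hMM', mul_one]
  have hcomm : ∀ X : Matrix (Fin m) (Fin m) ℂ, X * N = N * X →
      sylvester ψ (X, M⁻¹ * X * M) = 0 := by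
    intro X hX
    funext b
    rw [sylvester_apply]
    fin_cases b
    · show X * M - M * (M⁻¹ * X * M) = 0
      rw [mul_assoc, ← mul_assoc M, hMM, one_mul, sub_self]
    · show X * slice 1 ψ - slice 1 ψ * (M⁻¹ * X * M) = 0
      rw [← hNM, ← mul_assoc, hX, mul_assoc N M, mul_assoc M⁻¹, ← mul_assoc M, hMM, one_mul,
        mul_assoc, sub_self]
  let ev : dqlsSubspace ψ →ₗ[ℂ] (Fin m → ℂ) :=
    { toFun := fun w => slice 0 w.1 *ᵥ 1
      map_add' := fun w w' => by rw [Submodule.coe_add, map_add, add_mulVec]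
      map_smul' := fun z w => by
        rw [Submodule.coe_smul, map_smul, smul_mulVec, RingHom.id_apply] }
  have hinj : Function.Injective ev := by
    rw [injective_iff_map_eq_zero]
    rintro ⟨w, hw⟩ h
    obtain ⟨⟨Y, hY⟩, ⟨X, hX⟩⟩ := mem_dqlsSubspace.1 hw
    have h2 : cyclicMap ψ (X, Y) = cyclicMap ψ 0 := by
      rw [map_zero]
      refine Prod.ext ?_ ?_
      · funext b
        show X * slice b ψ - slice b ψ * Y = 0
        rw [← hX, ← hY, sub_self]
      · show (X * slice 0 ψ) *ᵥ 1 = 0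
        rw [← hX]
        exact h
    have hX0 : X = 0 := congrArg Prod.fst (h₁ h2)
    refine Subtype.ext (slice_injective fun b => ?_)
    rw [hX, hX0, Matrix.zero_mul]
    rfl
  have hsurj : Function.Surjective ev := by
    intro v
    obtain ⟨X, hX, hXv⟩ := exists_commute_mulVec_eq N (M *ᵥ 1) (fun X hX hX0 => by
      have h2 : cyclicMap ψ (X, M⁻¹ * X * M) = cyclicMap ψ 0 := by
        rw [map_zero]
        refine Prod.ext (hcomm X hX) ?_
        show (X * M) *ᵥ 1 = 0
        rw [← mulVec_mulVec, hX0]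
      exact congrArg Prod.fst (h₁ h2)) v
    refine ⟨⟨leftAct ψ X, mem_dqlsSubspace.2
      ⟨⟨M⁻¹ * X * M, fun b => ?_⟩, ⟨X, fun b => rfl⟩⟩⟩, ?_⟩
    · exact sub_eq_zero.1 (congrFun (hcomm X hX) b)
    · show (X * M) *ᵥ 1 = v
      rw [← mulVec_mulVec, hXv]
  rw [(LinearEquiv.ofBijective ev ⟨hinj, hsurj⟩).finrank_eq, Module.finrank_fin_fun]

end Square

end

end QuasiLocal

theorem theorem3p7 (da dc : ℕ) (ha : 1 ≤ da) :
    (dc = da →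
      QuasiLocal.ForGenericState fun ψ : EuclideanSpace ℂ (Fin da × Fin 2 × Fin dc) =>
        Module.finrank ℂ (QuasiLocal.dqlsSubspace ψ) = da ∧
        (2 ≤ da → ¬ QuasiLocal.IsDQLS ψ)) ∧
    (da < dc →
      QuasiLocal.ForGenericState fun ψ : EuclideanSpace ℂ (Fin da × Fin 2 × Fin dc) =>
        Module.finrank ℂ (QuasiLocal.dqlsSubspace ψ) = min (da ^ 2) ((dc - da) ^ 2) ∧
        (dc = da + 1 → QuasiLocal.IsDQLS ψ) ∧
        (2 ≤ da → dc ≠ da + 1 → ¬ QuasiLocal.IsDQLS ψ)) := by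
  open QuasiLocal in
  constructor
  · rintro rfl
    filter_upwards [forGenericState_injective (sliceVecMul 0) _ sliceVecMul_diagVec_injective,
      forGenericState_injective cyclicMap _ cyclicMap_diagVec_injective] with ψ h₀ h₁
    have hdim := finrank_dqlsSubspace_of_square h₀ h₁
    exact ⟨hdim, fun h2 => not_isDQLS_of_two_le_finrank (hdim.symm ▸ h2)⟩
  · intro hlt
    have hdim : ForGenericState fun ψ : EuclideanSpace ℂ (Fin da × Fin 2 × Fin dc) =>
        Module.finrank ℂ (dqlsSubspace ψ) = min (da ^ 2) ((dc - da) ^ 2) := by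
      rcases le_total dc (2 * da) with hle | hge
      · filter_upwards [forGenericState_injective (sliceVecMul 0) _
          (sliceVecMul_bandVec_injective hlt), forGenericState_injective slicesMulVec _
          (slicesMulVec_bandVec_injective hlt hle), forGenericState_surjective sylvester _
          (sylvester_bandVec_surjective hlt)] with ψ h₁ h₂ h₃
        have hrank := LinearMap.finrank_range_add_finrank_ker (sylvester ψ.val)
        rw [LinearMap.range_eq_top.2 h₃, finrank_top] at hrank
        simp only [Module.finrank_prod, Module.finrank_pi_fintype, Module.finrank_matrix,
          Module.finrank_self, Fintype.card_fin, Finset.sum_const, Finset.card_univ,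
          mul_one, smul_eq_mul] at hrank
        rw [finrank_dqlsSubspace_eq_finrank_ker h₁ h₂,
          min_eq_right (Nat.pow_le_pow_left (by omega) 2)]
        obtain ⟨k, rfl⟩ := Nat.exists_eq_add_of_lt hlt
        rw [show da + k + 1 - da = k + 1 by omega]
        -- `m² + n² - 2mn = (n - m)²`
        nlinarith
      · filter_upwards [forGenericState_injective (sliceVecMul 0) _
          (sliceVecMul_bandVec_injective hlt), forGenericState_surjective slicesMulVec _
          (slicesMulVec_bandVec_surjective hge)] with ψ h₁ h₂
        rw [finrank_dqlsSubspace_eq_sq h₁ h₂, Fintype.card_fin,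
          min_eq_left (Nat.pow_le_pow_left (by omega) 2)]
    have hDQLS : dc = da + 1 →
        ForGenericState fun ψ : EuclideanSpace ℂ (Fin da × Fin 2 × Fin dc) => IsDQLS ψ := by
      intro h
      filter_upwards [hdim, forGenericState_injective (sliceVecMul 0) _
        (sliceVecMul_bandVec_injective hlt), forGenericState_injective slicesMulVec _
        (slicesMulVec_bandVec_injective hlt (by omega))] with ψ hψ h₁ h₂
      have hnorm : ‖ψ.val‖ = 1 := by simp
      have hne : ψ.val ≠ 0 := fun h0 => by rw [h0, norm_zero] at hnorm; exact zero_ne_one hnorm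
      refine isDQLS_of_dqlsSubspace_le hnorm (coeffMatrix_splitAB_mulVec_injective h₂)
        (coeffMatrix_splitBC_mulVec_injective h₁) (le_of_eq ?_)
      have hle : Submodule.span ℂ {ψ.val} ≤ dqlsSubspace ψ.val :=
        (Submodule.span_singleton_le_iff_mem _ _).2 (self_mem_dqlsSubspace _)
      refine (Submodule.eq_of_le_of_finrank_eq hle ?_).symm
      rw [finrank_span_singleton hne, hψ, show dc - da = 1 by omega, one_pow,
        min_eq_right (Nat.one_le_pow _ _ ha)]
    by_cases h : dc = da + 1
    · filter_upwards [hdim, hDQLS h] with ψ hψ hψ'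
      exact ⟨hψ, fun _ => hψ', fun _ hne => absurd h hne⟩
    · filter_upwards [hdim] with ψ hψ
      refine ⟨hψ, fun h' => absurd h' h, fun h2 _ => not_isDQLS_of_two_le_finrank ?_⟩
      rw [hψ]
      have h3 : 2 ≤ dc - da := by omega
      exact le_min (h2.trans (Nat.le_self_pow two_ne_zero _))
        (h3.trans (Nat.le_self_pow two_ne_zero _))
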